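/- A finite non-empty set $C$ of unit vectors in Euclidean space $\mathbb{R}^n$ is called a spherical $L$-code, for a set $L$ of reals, if $\langle x,y\rangle\in L$ for all distinct $x,y\in C$. Let $\beta\in(0,1]$ and let $k\ge 0$ be an integer. (1) There is a constant $c_{\beta,k}$, depending only on $\beta$ and $k$, such that for all real numbers $\alpha_1,\dots,\alpha_k$ and all $n$, every spherical $\bigl([-1,-\beta]\cup\{\alpha_1,\dots,\alpha_k\}\bigr)$-code in $\mathbb{R}^n$ has size at most $c_{\beta,k}\,n^k$. (2) Suppose moreover that $k\ge 1$ and that $0\le\alpha_1<\dots<\alpha_k<1$ are fixed. Then every spherical $\bigl([-1,-\beta]\cup\{\alpha_1,\dots,\alpha_k\}\bigr)$-code in $\mathbb{R}^n$ has size at most $$2^k(k-1)!\Bigl(1+\frac{\alpha_1}{\beta}\Bigr)n^k+o(n^k)\qquad (n\to\infty),$$ where the error term $o(n^k)$ is a function of $n$ that may depend on $\beta,k,\alpha_1,\dots,\alpha_k$ but not on the code. -/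

import Mathlib

/-- A finite non-empty set `C` of unit vectors in Euclidean space `ℝⁿ` is a spherical `L`-code if
`⟨x, y⟩ ∈ L` for any pair of distinct vectors `x`, `y` in `C`. -/
def IsSphericalCode {n : ℕ} (L : Set ℝ) (C : Finset (EuclideanSpace ℝ (Fin n))) : Prop :=
  C.Nonempty ∧ (∀ x ∈ C, ‖x‖ = 1) ∧ ∀ x ∈ C, ∀ y ∈ C, x ≠ y → inner ℝ x y ∈ L

/-- The set `[-1, -β] ∪ {α₁, …, αₖ}` of admissible inner products (with indices shifted to start
at `0`). -/
def codeAngles {k : ℕ} (β : ℝ) (α : Fin k → ℝ) : Set ℝ :=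
  Set.Icc (-1) (-β) ∪ Set.range α

section SphericalCodes

open scoped Classical
open Finset

/-! ### Rank bounds -/

/-! Everything rests on the kernel ⟨x,y⟩ − c being positive semidefinite, exactly or up to ε per
entry (`NearPSD`); a Gram matrix has c = 0. Restricting to the points at product v from a given
point raises c to c + (v−c)²/(1−c), a Schur complement (`NearPSD.link`). Restricting to the points
joined at v to a large clique of product v makes c nearly v, since the clique's barycentre is a
common centre.

Sharp bound: induct on the number of products. Let a be the smallest one and A the r others. At
shift a, `UpperBound.rowBound` applies the inductive constant G to the neighbourhoods of a point at
each v in A, bounding the positive part of a row by about (1−a)·r·G·nʳ. By near positivity the low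
entries have no larger square sum, so trace² ≤ rank · Frobenius² gives 2rG·nʳ⁺¹
(`RowBound.codeBound`). At shift c ≤ a, `UpperBound.codeBound` splits the code into at most about 1
+ (a−c)/(c−b) clusters around a-cliques, each nearly positive at shift a, plus O(nʳ) points. Taking
c = 0, b = −β gives 1 + α₁/β; the factors 2r multiply to 2ᵏ(k−1)!.

Uniform bound (`exists_card_le_mul_pow`): Ramsey gives a positive proportion of points with a common
centre. A rapidly decreasing scale splits the products into small and large ones. Sets with only
small products obey the polynomial bound, large neighbourhoods are handled by induction, and low
ones by positivity. -/

/-- A matrix with nonzero trace has large rank or large Frobenius norm. -/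
theorem Matrix.IsHermitian.trace_sq_le_rank_mul {ι : Type*} [Fintype ι] {M : Matrix ι ι ℝ}
    (hM : M.IsHermitian) : M.trace ^ 2 ≤ M.rank * ∑ i, ∑ j, M i j ^ 2 := by
  have h1 : M.trace = ∑ i, hM.eigenvalues i := by
    simpa using hM.trace_eq_sum_eigenvalues
  have h2 : (M * M).trace = ∑ i, hM.eigenvalues i ^ 2 := by
    conv_lhs => rw [hM.spectral_theorem, ← map_mul, Unitary.conjStarAlgAut_apply,
      Matrix.trace_mul_comm, ← mul_assoc]
    simp [Matrix.diagonal_mul_diagonal, Matrix.trace_diagonal, sq]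
  have h3 : (M * M).trace = ∑ i, ∑ j, M i j ^ 2 := by
    simp only [Matrix.trace, Matrix.diag, Matrix.mul_apply]
    refine sum_congr rfl fun i _ => sum_congr rfl fun j _ => ?_
    have := hM.apply i j
    simp only [star_trivial] at this
    rw [this, sq]
  have h4 : (M.rank : ℝ) = #{i | hM.eigenvalues i ≠ 0} := by
    rw [hM.rank_eq_card_non_zero_eigs, Fintype.card_subtype]
  rw [← h3, h2, h1, h4]
  -- Dropping zero eigenvalues makes Cauchy–Schwarz cost the rank instead of the matrix size.
  have h5 : ∑ i, hM.eigenvalues i = ∑ i with hM.eigenvalues i ≠ 0, hM.eigenvalues i :=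
    (sum_filter_ne_zero _).symm
  rw [h5]
  refine sq_sum_le_card_mul_sum_sq.trans ?_
  gcongr
  exact subset_univ _

/-- Coordinates making `⟨x, y⟩ - a` a product of vectors of length `n + 1`. -/
theorem inner_sub_eq_sum_option {n : ℕ} (x y : EuclideanSpace ℝ (Fin n)) (a : ℝ) :
    inner ℝ x y - a =
      ∑ i : Option (Fin n), (i.elim 1 fun i => x i) * (i.elim (-a) fun i => y i) := by
  rw [Fintype.sum_option]
  simp only [Option.elim, PiLp.inner_apply, RCLike.inner_apply, conj_trivial]
  rw [one_mul, sub_eq_neg_add]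
  congr 1
  exact sum_congr rfl fun i _ => mul_comm _ _

theorem rank_gram_sub_le {n : ℕ} (B : Finset (EuclideanSpace ℝ (Fin n))) (a : ℝ) :
    (Matrix.of fun x y : B => inner ℝ (x : EuclideanSpace ℝ (Fin n)) y - a).rank ≤ n + 1 := by
  have : (Matrix.of fun x y : B => inner ℝ (x : EuclideanSpace ℝ (Fin n)) y - a) =
      (Matrix.of fun (x : B) (i : Option (Fin n)) => i.elim 1 fun i => x.1 i) *
      (Matrix.of fun (i : Option (Fin n)) (y : B) => i.elim (-a) fun i => y.1 i) := by
    ext x y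
    simp only [Matrix.mul_apply, Matrix.of_apply]
    exact inner_sub_eq_sum_option x.1 y.1 a
  rw [this]
  refine (Matrix.rank_mul_le_left _ _).trans ((Matrix.rank_le_card_width _).trans ?_)
  simp

/-- The rank–trace inequality for the kernel ⟨x,y⟩ − a, whose diagonal is 1 − a and whose rank is at
most n + 1. -/
theorem card_sq_le_of_gram {n : ℕ} {B : Finset (EuclideanSpace ℝ (Fin n))}
    (hB : ∀ x ∈ B, ‖x‖ = 1) (a : ℝ) :
    ((1 - a) * #B) ^ 2 ≤ (n + 1) * ∑ x ∈ B, ∑ y ∈ B, (inner ℝ x y - a) ^ 2 := by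
  set M : Matrix B B ℝ :=
    Matrix.of fun x y : B => inner ℝ (x : EuclideanSpace ℝ (Fin n)) y - a with hM
  have hH : M.IsHermitian := by
    ext x y
    simp [hM, real_inner_comm]
  have htr : M.trace = (1 - a) * #B := by
    have : ∀ x : B, M x x = 1 - a := fun x => by
      simp [hM, hB x.1 x.2]
    simp [Matrix.trace, this]
    ring
  have hF : ∑ i, ∑ j, M i j ^ 2 = ∑ x ∈ B, ∑ y ∈ B, (inner ℝ x y - a) ^ 2 := by
    rw [← sum_coe_sort B]
    refine sum_congr rfl fun x _ => ?_
    rw [← sum_coe_sort B]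
    rfl
  have h := hH.trace_sq_le_rank_mul
  rw [htr, hF] at h
  refine h.trans ?_
  gcongr
  exact_mod_cast rank_gram_sub_le B a

/-- The polynomial method bound for sets with few inner products. -/
theorem card_le_of_inner_mem {n : ℕ} {B : Finset (EuclideanSpace ℝ (Fin n))}
    (hB : ∀ x ∈ B, ‖x‖ = 1) (A : Finset ℝ) (hA : ∀ a ∈ A, a < 1)
    (h : ∀ x ∈ B, ∀ y ∈ B, x ≠ y → inner ℝ x y ∈ A) : #B ≤ (n + 1) ^ #A := by
  set M : Matrix B B ℝ :=
    Matrix.of fun x y : B => ∏ a : A, (inner ℝ (x : EuclideanSpace ℝ (Fin n)) y - a) with hM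
  have hdiag : M = Matrix.diagonal fun _ => ∏ a : A, (1 - (a : ℝ)) := by
    ext x y
    rcases eq_or_ne x y with rfl | hxy
    · simp [hM, hB x.1 x.2]
    · rw [Matrix.diagonal_apply_ne _ hxy]
      refine prod_eq_zero (mem_univ ⟨_, h x.1 x.2 y.1 y.2 fun h => hxy (Subtype.ext h)⟩) ?_
      simp
  have hrank : M.rank = #B := by
    have : ∏ a : A, (1 - (a : ℝ)) ≠ 0 :=
      prod_ne_zero_iff.2 fun a _ => (sub_pos.2 (hA a.1 a.2)).ne'
    rw [hdiag, Matrix.rank_diagonal, Fintype.card_subtype, filter_true_of_mem fun _ _ => this]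
    simp
  -- Expanding a product of #A sums of n + 1 terms factors `M` through a space of dimension
  -- (n+1)^#A.
  have hmul : M = (Matrix.of fun (x : B) (g : A → Option (Fin n)) =>
        ∏ a, (g a).elim 1 fun i => x.1 i) *
      (Matrix.of fun (g : A → Option (Fin n)) (y : B) =>
        ∏ a : A, (g a).elim (-(a : ℝ)) fun i => y.1 i) := by
    ext x y
    simp only [hM, Matrix.mul_apply, Matrix.of_apply, inner_sub_eq_sum_option]
    rw [prod_univ_sum]
    simp [prod_mul_distrib]
  rw [← hrank, hmul]
  refine (Matrix.rank_mul_le_left _ _).trans ((Matrix.rank_le_card_width _).trans ?_)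
  simp

/-! ### Approximately positive semidefinite shifts of the Gram matrix -/

variable {V : Type*} [NormedAddCommGroup V] [InnerProductSpace ℝ V]

/-- The kernel `⟨x, y⟩ - c` on `B` is positive semidefinite up to an error of `ε` per entry. -/
def NearPSD (B : Finset V) (c ε : ℝ) : Prop :=
  ∀ w : V → ℝ, -(ε * (∑ x ∈ B, |w x|) ^ 2) ≤
    ∑ x ∈ B, ∑ y ∈ B, w x * w y * (inner ℝ x y - c)

theorem NearPSD.subset {B R : Finset V} {c ε : ℝ} (h : NearPSD B c ε) (hR : R ⊆ B) :
    NearPSD R c ε := by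
  intro w
  have := h fun x => if x ∈ R then w x else 0
  simpa [apply_ite abs, ite_mul, mul_ite, sum_ite_mem, inter_eq_right.2 hR] using this

theorem NearPSD.mono_error {B : Finset V} {c ε ε' : ℝ} (h : NearPSD B c ε) (hε : ε ≤ ε') :
    NearPSD B c ε' := fun w => by
  refine le_trans ?_ (h w)
  gcongr

/-- Lowering c adds a nonnegative multiple of the all-ones kernel. -/
theorem NearPSD.mono_shift {B : Finset V} {c c' ε : ℝ} (h : NearPSD B c ε) (hc : c' ≤ c) :
    NearPSD B c' ε := fun w => by
  refine (h w).trans ?_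
  have : ∑ x ∈ B, ∑ y ∈ B, w x * w y * (inner ℝ x y - c') =
      ∑ x ∈ B, ∑ y ∈ B, w x * w y * (inner ℝ x y - c) + (c - c') * (∑ x ∈ B, w x) ^ 2 := by
    rw [sq, sum_mul_sum, mul_sum, ← sum_add_distrib]
    refine sum_congr rfl fun x _ => ?_
    rw [mul_sum, ← sum_add_distrib]
    exact sum_congr rfl fun y _ => by ring
  rw [this]
  have := mul_nonneg (sub_nonneg.2 hc) (sq_nonneg (∑ x ∈ B, w x))
  linarith

/-- The kernel is the Gram matrix of the translates x − s. -/
theorem sum_sum_inner_sub_center (B : Finset V) (w : V → ℝ) (s : V) :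
    0 ≤ ∑ x ∈ B, ∑ y ∈ B, w x * w y * (inner ℝ x y - inner ℝ x s - inner ℝ y s + ‖s‖ ^ 2) := by
  have : ∑ x ∈ B, ∑ y ∈ B,
      w x * w y * (inner ℝ x y - inner ℝ x s - inner ℝ y s + ‖s‖ ^ 2) =
      inner ℝ (∑ x ∈ B, w x • (x - s)) (∑ x ∈ B, w x • (x - s)) := by
    rw [sum_inner]
    refine sum_congr rfl fun x _ => ?_
    rw [inner_sum]
    refine sum_congr rfl fun y _ => ?_
    rw [real_inner_smul_left, real_inner_smul_right, inner_sub_left, inner_sub_right,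
      inner_sub_right, real_inner_self_eq_norm_sq, real_inner_comm y s]
    ring
  rw [this]
  exact real_inner_self_nonneg

theorem NearPSD.of_center {B : Finset V} {s : V} {θ : ℝ} (h : ∀ x ∈ B, inner ℝ x s = θ) :
    NearPSD B (2 * θ - ‖s‖ ^ 2) 0 := fun w => by
  rw [zero_mul, neg_zero]
  refine (sum_sum_inner_sub_center B w s).trans_eq ?_
  refine sum_congr rfl fun x hx => sum_congr rfl fun y hy => ?_
  rw [h x hx, h y hy]
  ring

theorem NearPSD.of_near_center {B : Finset V} {s : V} {a η : ℝ}
    (h : ∀ x ∈ B, |inner ℝ x s - a| ≤ η) (hs : |‖s‖ ^ 2 - a| ≤ η) : NearPSD B a (3 * η) := by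
  intro w
  have h0 := sum_sum_inner_sub_center B w s
  have h1 : ∑ x ∈ B, ∑ y ∈ B,
      w x * w y * (inner ℝ x y - inner ℝ x s - inner ℝ y s + ‖s‖ ^ 2) ≤
      ∑ x ∈ B, ∑ y ∈ B, (w x * w y * (inner ℝ x y - a) + 3 * η * (|w x| * |w y|)) := by
    refine sum_le_sum fun x hx => sum_le_sum fun y hy => ?_
    have hd : |‖s‖ ^ 2 - a - (inner ℝ x s - a) - (inner ℝ y s - a)| ≤ 3 * η := by
      have := h x hx
      have := h y hy
      rw [abs_le] at *
      constructor <;> linarith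
    have : w x * w y * (‖s‖ ^ 2 - a - (inner ℝ x s - a) - (inner ℝ y s - a)) ≤
        3 * η * (|w x| * |w y|) := by
      refine (le_abs_self _).trans ?_
      rw [abs_mul, abs_mul, mul_comm]
      gcongr
    linarith
  have h2 : ∑ x ∈ B, ∑ y ∈ B, (w x * w y * (inner ℝ x y - a) + 3 * η * (|w x| * |w y|)) =
      ∑ x ∈ B, ∑ y ∈ B, w x * w y * (inner ℝ x y - a) + 3 * η * (∑ x ∈ B, |w x|) ^ 2 := by
    rw [sq, sum_mul_sum, mul_sum, ← sum_add_distrib]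
    refine sum_congr rfl fun x _ => ?_
    rw [mul_sum, ← sum_add_distrib]
  linarith

/-- Testing near positivity with weights on `R` plus a weight `τ` at a point `z`. -/
theorem NearPSD.add_single {B R : Finset V} {c ε : ℝ} (h : NearPSD B c ε) (hε : 0 ≤ ε)
    (hR : R ⊆ B) {z : V} (hz : z ∈ B) (hz1 : ‖z‖ = 1) (w : V → ℝ) (τ : ℝ) :
    -(ε * (∑ x ∈ R, |w x| + |τ|) ^ 2) ≤
      ∑ x ∈ R, ∑ y ∈ R, w x * w y * (inner ℝ x y - c) +
        2 * τ * ∑ x ∈ R, w x * (inner ℝ x z - c) + τ ^ 2 * (1 - c) := by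
  have key := h fun x => (if x ∈ R then w x else 0) + if x = z then τ else 0
  have habs : ∑ x ∈ B, |(if x ∈ R then w x else 0) + if x = z then τ else 0| ≤
      ∑ x ∈ R, |w x| + |τ| := by
    calc _ ≤ ∑ x ∈ B, ((if x ∈ R then |w x| else 0) + if x = z then |τ| else 0) := by
          refine sum_le_sum fun x _ => (abs_add_le _ _).trans_eq ?_
          simp [apply_ite abs]
      _ = _ := by
          rw [sum_add_distrib, sum_ite_mem, inter_eq_right.2 hR, sum_ite_eq' B z, if_pos hz]
  have hform : ∑ x ∈ B, ∑ y ∈ B, ((if x ∈ R then w x else 0) + if x = z then τ else 0) *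
      ((if y ∈ R then w y else 0) + if y = z then τ else 0) * (inner ℝ x y - c) =
      ∑ x ∈ R, ∑ y ∈ R, w x * w y * (inner ℝ x y - c) +
        2 * τ * ∑ x ∈ R, w x * (inner ℝ x z - c) + τ ^ 2 * (1 - c) := by
    have hin : ∀ x, ∑ y ∈ B, ((if x ∈ R then w x else 0) + if x = z then τ else 0) *
        ((if y ∈ R then w y else 0) + if y = z then τ else 0) * (inner ℝ x y - c) =
        ((if x ∈ R then w x else 0) + if x = z then τ else 0) *
          (∑ y ∈ R, w y * (inner ℝ x y - c) + τ * (inner ℝ x z - c)) := by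
      intro x
      simp only [mul_assoc]
      rw [← mul_sum]
      congr 1
      simp only [add_mul, ite_mul, zero_mul]
      rw [sum_add_distrib, sum_ite_mem, inter_eq_right.2 hR, sum_ite_eq' B z, if_pos hz]
    simp only [hin]
    simp only [add_mul, ite_mul, zero_mul]
    rw [sum_add_distrib, sum_ite_mem, inter_eq_right.2 hR, sum_ite_eq' B z, if_pos hz]
    simp only [mul_add, sum_add_distrib]
    have e1 : ∀ x, w x * ∑ y ∈ R, w y * (inner ℝ x y - c) =
        ∑ y ∈ R, w x * w y * (inner ℝ x y - c) := fun x => by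
      rw [mul_sum]; exact sum_congr rfl fun y _ => by ring
    have e2 : ∑ x ∈ R, w x * (τ * (inner ℝ x z - c)) =
        τ * ∑ x ∈ R, w x * (inner ℝ x z - c) := by
      rw [mul_sum]; exact sum_congr rfl fun y _ => by ring
    have e3 : ∑ x ∈ R, w x * (inner ℝ z x - c) = ∑ x ∈ R, w x * (inner ℝ x z - c) :=
      sum_congr rfl fun y _ => by rw [real_inner_comm]
    simp only [e1, e2, e3, real_inner_self_eq_norm_sq, hz1]
    ring
  rw [hform] at key
  refine le_trans ?_ key
  have h0 : 0 ≤ ∑ x ∈ B, |(if x ∈ R then w x else 0) + if x = z then τ else 0| :=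
    sum_nonneg fun x _ => abs_nonneg _
  gcongr

/-- Near positivity improves on the set of points having a fixed inner product with a point. -/
theorem NearPSD.link {B R : Finset V} {c ε v : ℝ} (h : NearPSD B c ε) (hε : 0 ≤ ε)
    (hR : R ⊆ B) {z : V} (hz : z ∈ B) (hz1 : ‖z‖ = 1) (hv : ∀ x ∈ R, inner ℝ x z = v)
    (hcv : c ≤ v) (hv1 : v ≤ 1) (hc : c < 1) :
    NearPSD R (c + (v - c) ^ 2 / (1 - c)) (4 * ε) := by
  intro w
  have hc' : 0 < 1 - c := sub_pos.2 hc
  -- The weight −l·Σw at z minimises the form. Since 0 ≤ l ≤ 1 it at most doubles the total mass,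
  -- whence 4ε.
  set l := (v - c) / (1 - c) with hl
  have hl0 : 0 ≤ l := div_nonneg (sub_nonneg.2 hcv) hc'.le
  have hl1 : l ≤ 1 := (div_le_one hc').2 (by linarith)
  have key := h.add_single hε hR hz hz1 w (-(l * ∑ x ∈ R, w x))
  have e1 : ∑ x ∈ R, w x * (inner ℝ x z - c) = (v - c) * ∑ x ∈ R, w x := by
    rw [mul_sum]
    exact sum_congr rfl fun x hx => by rw [hv x hx]; ring
  have e2 : ∑ x ∈ R, ∑ y ∈ R, w x * w y * (inner ℝ x y - (c + (v - c) ^ 2 / (1 - c))) =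
      ∑ x ∈ R, ∑ y ∈ R, w x * w y * (inner ℝ x y - c) -
        (v - c) ^ 2 / (1 - c) * (∑ x ∈ R, w x) ^ 2 := by
    rw [sq (∑ x ∈ R, w x), sum_mul_sum, mul_sum, ← sum_sub_distrib]
    refine sum_congr rfl fun x _ => ?_
    rw [mul_sum, ← sum_sub_distrib]
    exact sum_congr rfl fun y _ => by ring
  have e3 : (v - c) ^ 2 / (1 - c) = l * (v - c) := by rw [hl]; ring
  have e4 : l * (1 - c) = v - c := div_mul_cancel₀ _ hc'.ne'
  rw [e2, e3]
  rw [e1] at key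
  have habs : |-(l * ∑ x ∈ R, w x)| ≤ ∑ x ∈ R, |w x| := by
    rw [abs_neg, abs_mul, abs_of_nonneg hl0]
    calc l * |∑ x ∈ R, w x| ≤ 1 * |∑ x ∈ R, w x| := by gcongr
      _ ≤ _ := by rw [one_mul]; exact abs_sum_le_sum_abs _ _
  have hsq : ε * (∑ x ∈ R, |w x| + |-(l * ∑ x ∈ R, w x)|) ^ 2 ≤
      ε * (∑ x ∈ R, |w x| + ∑ x ∈ R, |w x|) ^ 2 := by
    gcongr
  have e5 : 2 * -(l * ∑ x ∈ R, w x) * ((v - c) * ∑ x ∈ R, w x) +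
      (-(l * ∑ x ∈ R, w x)) ^ 2 * (1 - c) = -(l * (v - c) * (∑ x ∈ R, w x) ^ 2) := by
    have : (-(l * ∑ x ∈ R, w x)) ^ 2 * (1 - c) =
      l * (l * (1 - c)) * (∑ x ∈ R, w x) ^ 2 := by ring
    rw [this, e4]; ring
  linarith

/-! ### Averages of cliques -/

/-- The barycenter of a finite set. -/
noncomputable def avg (S : Finset V) : V := (#S : ℝ)⁻¹ • ∑ x ∈ S, x

theorem inner_avg (S : Finset V) (x : V) :
    inner ℝ x (avg S) = (#S : ℝ)⁻¹ * ∑ y ∈ S, inner ℝ x y := by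
  rw [avg, real_inner_smul_right, inner_sum]

theorem inner_avg_le {S : Finset V} (hS : S.Nonempty) {x : V} {v : ℝ}
    (h : ∀ y ∈ S, inner ℝ x y ≤ v) : inner ℝ x (avg S) ≤ v := by
  have hc : (0 : ℝ) < #S := by exact_mod_cast hS.card_pos
  rw [inner_avg, inv_mul_le_iff₀ hc]
  simpa using sum_le_card_nsmul S _ v h

theorem le_inner_avg {S : Finset V} (hS : S.Nonempty) {x : V} {v : ℝ}
    (h : ∀ y ∈ S, v ≤ inner ℝ x y) : v ≤ inner ℝ x (avg S) := by
  have hc : (0 : ℝ) < #S := by exact_mod_cast hS.card_pos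
  rw [inner_avg, ← div_eq_inv_mul, le_div_iff₀ hc, mul_comm]
  simpa using card_nsmul_le_sum S _ v h

theorem inner_avg_eq {S : Finset V} (hS : S.Nonempty) {x : V} {v : ℝ}
    (h : ∀ y ∈ S, inner ℝ x y = v) : inner ℝ x (avg S) = v :=
  le_antisymm (inner_avg_le hS fun y hy => (h y hy).le) (le_inner_avg hS fun y hy => (h y hy).ge)

/-- Unit vectors in `S` have all pairwise inner products equal to `v`. -/
def IsEquiangular (S : Finset V) (v : ℝ) : Prop :=
  (∀ x ∈ S, ‖x‖ = 1) ∧ ∀ x ∈ S, ∀ y ∈ S, x ≠ y → inner ℝ x y = v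

theorem IsEquiangular.subset {S T : Finset V} {v : ℝ} (h : IsEquiangular S v) (hT : T ⊆ S) :
    IsEquiangular T v :=
  ⟨fun x hx => h.1 x (hT hx), fun x hx y hy => h.2 x (hT hx) y (hT hy)⟩

theorem IsEquiangular.norm_avg_sq {S : Finset V} {v : ℝ} (h : IsEquiangular S v)
    (hS : S.Nonempty) : ‖avg S‖ ^ 2 = v + (1 - v) / #S := by
  have hc : (0 : ℝ) < #S := by exact_mod_cast hS.card_pos
  have h1 : ∀ x ∈ S, inner ℝ (avg S) x = v + (1 - v) / #S := by
    intro x hx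
    rw [real_inner_comm, inner_avg, ← add_sum_erase S _ hx, real_inner_self_eq_norm_sq, h.1 x hx,
      sum_congr rfl fun y hy => h.2 x hx y (mem_of_mem_erase hy) (ne_of_mem_erase hy).symm,
      sum_const, card_erase_of_mem hx, nsmul_eq_mul, Nat.cast_sub hS.card_pos]
    field_simp
    push_cast
    ring
  rw [← real_inner_self_eq_norm_sq]
  exact inner_avg_eq hS h1

/-! ### A Ramsey argument -/

/-- In every large coloured set there are a large monochromatic clique and a positive proportion of
the points joined to this clique in its colour. -/
theorem exists_clique_with_joined_set (k s : ℕ) :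
    ∃ K : ℕ, 0 < K ∧ ∀ (κ : Type) (T : Finset κ) (f : κ → ℕ), #T ≤ k → ∑ i ∈ T, f i ≤ s →
      ∀ {V : Type} (col : V → V → κ), (∀ x y, col x y = col y x) → ∀ B : Finset V,
        (∀ x ∈ B, ∀ y ∈ B, x ≠ y → col x y ∈ T) → K ≤ #B → T.Nonempty →
        ∃ i ∈ T, ∃ S ⊆ B, ∃ R ⊆ B, #S = f i ∧ #B ≤ K * #R ∧
          (∀ x ∈ S, ∀ y ∈ S, x ≠ y → col x y = i) ∧ ∀ x ∈ R, ∀ y ∈ S, x ≠ y ∧ col x y = i := by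
  induction s with
  | zero =>
    refine ⟨1, one_pos, ?_⟩
    intro κ T f _ hf V col _ B _ _ hT
    obtain ⟨i, hi⟩ := hT
    have hfi : f i = 0 := by
      have := single_le_sum (f := f) (fun j _ => Nat.zero_le _) hi
      omega
    exact ⟨i, hi, ∅, by simp, B, subset_rfl, by simp [hfi], by simp, by simp, by simp⟩
  | succ s ih =>
    obtain ⟨K, hK, ih⟩ := ih
    -- The factor k + 1 pays for the pigeonhole over colours at a vertex z, the factor 2 for
    -- removing z.
    refine ⟨2 * (k + 1) * (K + 1), by positivity, ?_⟩
    intro κ T f hT hf V col hsymm B hB hBK hTne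
    by_cases h0 : ∃ i ∈ T, f i = 0
    · obtain ⟨i, hi, hfi⟩ := h0
      exact ⟨i, hi, ∅, by simp, B, subset_rfl, by simp [hfi],
        Nat.le_mul_of_pos_left _ (by positivity), by simp, by simp⟩
    push Not at h0
    have hBpos : 0 < #B := lt_of_lt_of_le (by positivity) hBK
    obtain ⟨z, hz⟩ := card_pos.1 hBpos
    have hcard : #(B.erase z) = #B - 1 := card_erase_of_mem hz
    obtain ⟨i, hi, hR⟩ : ∃ i ∈ T, #(B.erase z) ≤ (k + 1) * #{x ∈ B.erase z | col x z = i} := by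
      by_contra! hcon
      have hsum : #(B.erase z) = ∑ i ∈ T, #{x ∈ B.erase z | col x z = i} :=
        card_eq_sum_card_fiberwise fun x hx => by
          have hx' := mem_erase.1 (mem_coe.1 hx)
          exact hB x hx'.2 z hz hx'.1
      have h1 : (k + 1) * #(B.erase z) ≤ #T * #(B.erase z) := by
        conv_lhs => rw [hsum]
        rw [mul_sum, ← smul_eq_mul (#T)]
        exact sum_le_card_nsmul _ _ _ fun i hi => (hcon i hi).le
      have h2 : 0 < #(B.erase z) := by
        have : 2 ≤ 2 * (k + 1) * (K + 1) := by nlinarith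
        omega
      have := Nat.le_of_mul_le_mul_right h1 h2
      omega
    set R1 := {x ∈ B.erase z | col x z = i} with hR1
    have hR1B : R1 ⊆ B := (filter_subset _ _).trans (erase_subset _ _)
    have hBR : #B ≤ 2 * (k + 1) * #R1 := by
      have : 2 ≤ #B := le_trans (by nlinarith) hBK
      have e : 2 * (k + 1) * #R1 = 2 * ((k + 1) * #R1) := by ring
      omega
    have hKR : K ≤ #R1 := by
      have h3 := hBK.trans hBR
      have := Nat.le_of_mul_le_mul_left h3 (by positivity)
      omega
    -- Every point of `R1` is joined to z in colour i, so z can complete a clique of that colour;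
    -- one vertex fewer is then requested in colour i.
    have hsum' : ∑ j ∈ T, Function.update f i (f i - 1) j ≤ s := by
      have e1 := add_sum_erase T f hi
      have e2 := add_sum_erase T (Function.update f i (f i - 1)) hi
      have e3 : ∑ j ∈ T.erase i, Function.update f i (f i - 1) j = ∑ j ∈ T.erase i, f j :=
        sum_congr rfl fun j hj => Function.update_of_ne (ne_of_mem_erase hj) _ _
      rw [Function.update_self, e3] at e2
      have := h0 i hi
      omega
    obtain ⟨j, hj, S, hS, R, hRR, hSc, hRc, hclique, hjoin⟩ :=
      ih κ T (Function.update f i (f i - 1)) hT hsum' col hsymm R1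
        (fun x hx y hy => hB x (hR1B hx) y (hR1B hy)) hKR hTne
    have hcardR : #B ≤ 2 * (k + 1) * (K + 1) * #R := by
      calc #B ≤ 2 * (k + 1) * #R1 := hBR
        _ ≤ 2 * (k + 1) * ((K + 1) * #R) := by gcongr; nlinarith
        _ = _ := by ring
    by_cases hji : j = i
    · subst hji
      have hz' : ∀ x ∈ R1, x ≠ z ∧ col x z = j := fun x hx => by
        rw [hR1, mem_filter, mem_erase] at hx
        exact ⟨hx.1.1, hx.2⟩
      have hzS : z ∉ S := fun h => (hz' z (hS h)).1 rfl
      refine ⟨j, hj, insert z S, insert_subset hz (hS.trans hR1B), R, hRR.trans hR1B, ?_, hcardR,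
        ?_, ?_⟩
      · rw [card_insert_of_notMem hzS, hSc, Function.update_self]
        have := h0 j hj
        omega
      · intro x hx y hy hxy
        rw [mem_insert] at hx hy
        rcases hx with rfl | hx <;> rcases hy with rfl | hy
        · exact absurd rfl hxy
        · rw [hsymm]; exact (hz' y (hS hy)).2
        · exact (hz' x (hS hx)).2
        · exact hclique x hx y hy hxy
      · intro x hx y hy
        rw [mem_insert] at hy
        rcases hy with rfl | hy
        · exact hz' x (hRR hx)
        · exact hjoin x hx y hy
    · refine ⟨j, hj, S, hS.trans hR1B, R, hRR.trans hR1B, ?_, hcardR, hclique, hjoin⟩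
      rw [hSc, Function.update_of_ne hji]

/-! ### Codes with finitely many large inner products -/

/-- Unit vectors whose pairwise inner products lie in `A` or are at most `b`. -/
def IsCode (B : Finset V) (A : Finset ℝ) (b : ℝ) : Prop :=
  (∀ x ∈ B, ‖x‖ = 1) ∧ ∀ x ∈ B, ∀ y ∈ B, x ≠ y → inner ℝ x y ∈ A ∨ inner ℝ x y ≤ b

theorem IsCode.subset {B R : Finset V} {A : Finset ℝ} {b : ℝ} (h : IsCode B A b) (hR : R ⊆ B) :
    IsCode R A b :=
  ⟨fun x hx => h.1 x (hR hx), fun x hx y hy => h.2 x (hR hx) y (hR hy)⟩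

theorem IsCode.of_insert {B : Finset V} {A : Finset ℝ} {a b : ℝ} (h : IsCode B (insert a A) b)
    (hb : b ≤ a) : IsCode B A a := by
  refine ⟨h.1, fun x hx y hy hxy => ?_⟩
  rcases h.2 x hx y hy hxy with h | h
  · rcases mem_insert.1 h with h | h
    · exact Or.inr h.le
    · exact Or.inl h
  · exact Or.inr (h.trans hb)

theorem inner_lt_one_of_ne {x y : V} (hx : ‖x‖ = 1) (hy : ‖y‖ = 1) (h : x ≠ y) :
    inner ℝ x y < 1 :=
  (inner_lt_one_iff_real_of_norm_eq_one hx hy).2 h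

theorem inner_le_one {x y : V} (hx : ‖x‖ = 1) (hy : ‖y‖ = 1) : inner ℝ x y ≤ 1 := by
  simpa [hx, hy] using real_inner_le_norm x y

theorem neg_one_le_inner {x y : V} (hx : ‖x‖ = 1) (hy : ‖y‖ = 1) : -1 ≤ inner ℝ x y := by
  have := neg_le_of_abs_le (abs_real_inner_le_norm x y)
  simpa [hx, hy] using this

/-- Ramsey with the products in `A` as colours and one further colour, `none`, for products at most
b; only the clique is kept in that case. -/
theorem IsCode.exists_clique (k m : ℕ) : ∃ K : ℕ, 0 < K ∧ ∀ {V : Type} [NormedAddCommGroup V]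
    [InnerProductSpace ℝ V] (B : Finset V) (A : Finset ℝ) (b : ℝ), #A ≤ k → IsCode B A b →
    K ≤ #B → (∃ S ⊆ B, #S = m ∧ ∀ x ∈ S, ∀ y ∈ S, x ≠ y → inner ℝ x y ≤ b) ∨
      ∃ v ∈ A, ∃ S ⊆ B, ∃ R ⊆ B, #S = m ∧ #B ≤ K * #R ∧ IsEquiangular S v ∧
        ∀ x ∈ R, ∀ y ∈ S, x ≠ y ∧ inner ℝ x y = v := by
  obtain ⟨K, hK, h⟩ := exists_clique_with_joined_set (k + 1) ((k + 1) * m)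
  refine ⟨K, hK, ?_⟩
  intro V _ _ B A b hA hB hKB
  set col : V → V → Option ℝ := fun x y =>
    if inner ℝ x y ∈ A then some (inner ℝ x y) else none with hcol
  have hcol1 : ∀ x y v, col x y = some v → inner ℝ x y = v := by
    intro x y v hxy
    simp only [hcol] at hxy
    split_ifs at hxy with h
    exact Option.some_injective _ hxy
  have hcol2 : ∀ x y, col x y = none → inner ℝ x y ∉ A := by
    intro x y hxy
    simp only [hcol] at hxy
    split_ifs at hxy with h
    exact h
  have hT : #(insertNone A) ≤ k + 1 := by simpa [card_insertNone] using hA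
  obtain ⟨i, hi, S, hS, R, hR, hSc, hRc, h1, h2⟩ :=
    h (Option ℝ) (insertNone A) (fun _ => m) hT
      (by simpa using Nat.mul_le_mul_right m hT) col
      (fun x y => by simp only [hcol, real_inner_comm]) B
      (fun x _ y _ _ => by
        simp only [hcol]
        split_ifs with h <;> simp [h]) hKB ⟨none, by simp⟩
  cases i with
  | none =>
    left
    refine ⟨S, hS, hSc, fun x hx y hy hxy => ?_⟩
    exact (hB.2 x (hS hx) y (hS hy) hxy).resolve_left (hcol2 x y (h1 x hx y hy hxy))
  | some v =>
    right
    refine ⟨v, by simpa using hi, S, hS, R, hR, hSc, hRc,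
      ⟨fun x hx => hB.1 x (hS hx), fun x hx y hy hxy => hcol1 x y v (h1 x hx y hy hxy)⟩, ?_⟩
    exact fun x hx y hy => ⟨(h2 x hx y hy).1, hcol1 x y v (h2 x hx y hy).2⟩

/-- Testing near positivity with constant weights. -/
theorem NearPSD.sum_nonneg_of_row {B : Finset V} {c ε ρ : ℝ} (h : NearPSD B c ε)
    (hB : B.Nonempty) (hρ : ∀ x ∈ B, ∑ y ∈ B, (inner ℝ x y - c) ≤ ρ) :
    -(ε * #B) ≤ ρ := by
  have h1 := h fun _ => 1
  simp only [abs_one, one_mul, sum_const, nsmul_eq_mul, mul_one] at h1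
  have h2 := sum_le_card_nsmul B _ ρ hρ
  rw [nsmul_eq_mul] at h2
  have hc : (0 : ℝ) < #B := by exact_mod_cast hB.card_pos
  have h3 : (#B : ℝ) * -(ε * #B) ≤ #B * ρ := by nlinarith
  exact le_of_mul_le_mul_left h3 hc

/-- Constant weights: when ε < c − b this bounds the size of a clique with products at most b. -/
theorem NearPSD.low_clique {B S : Finset V} {b c ε : ℝ} (h : NearPSD B c ε) (hS : S ⊆ B)
    (hne : S.Nonempty) (hB : ∀ x ∈ B, ‖x‖ = 1)
    (hb : ∀ x ∈ S, ∀ y ∈ S, x ≠ y → inner ℝ x y ≤ b) :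
    -(ε * #S) ≤ 1 - c - (#S - 1) * (c - b) := by
  refine (h.subset hS).sum_nonneg_of_row hne fun x hx => ?_
  rw [← add_sum_erase S _ hx, real_inner_self_eq_norm_sq, hB x (hS hx)]
  have : ∑ y ∈ S.erase x, (inner ℝ x y - c) ≤ #(S.erase x) • (b - c) :=
    sum_le_card_nsmul _ _ _ fun y hy => sub_le_sub_right
      (hb x hx y (mem_of_mem_erase hy) (ne_of_mem_erase hy).symm) _
  rw [card_erase_of_mem hx, nsmul_eq_mul, Nat.cast_sub hne.card_pos] at this
  push_cast at this
  linarith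

/-! ### Codes clustered around a common centre -/

/-- Schur's test, from 2·w x·w y ≤ w x² + w y². -/
theorem sum_mul_mul_le_of_row {ι : Type*} (L : Finset ι) (K : ι → ι → ℝ) (w : ι → ℝ) {ρ : ℝ}
    (hK : ∀ x ∈ L, ∀ y ∈ L, 0 ≤ K x y) (hsymm : ∀ x y, K x y = K y x)
    (hρ : ∀ x ∈ L, ∑ y ∈ L, K x y ≤ ρ) :
    ∑ x ∈ L, ∑ y ∈ L, w x * w y * K x y ≤ ρ * ∑ x ∈ L, w x ^ 2 := by
  have h1 : ∑ x ∈ L, ∑ y ∈ L, w x * w y * K x y ≤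
      ∑ x ∈ L, ∑ y ∈ L, (w x ^ 2 * K x y / 2 + w y ^ 2 * K x y / 2) := by
    refine sum_le_sum fun x hx => sum_le_sum fun y hy => ?_
    have := mul_nonneg (hK x hx y hy) (sq_nonneg (w x - w y))
    nlinarith
  have h2 : ∑ x ∈ L, ∑ y ∈ L, (w x ^ 2 * K x y / 2 + w y ^ 2 * K x y / 2) =
      ∑ x ∈ L, ∑ y ∈ L, w x ^ 2 * K x y := by
    simp only [sum_add_distrib]
    have : ∑ x ∈ L, ∑ y ∈ L, w y ^ 2 * K x y / 2 = ∑ x ∈ L, ∑ y ∈ L, w x ^ 2 * K x y / 2 := by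
      rw [sum_comm]
      exact sum_congr rfl fun x _ => sum_congr rfl fun y _ => by rw [hsymm]
    rw [this, ← sum_add_distrib]
    refine sum_congr rfl fun x _ => ?_
    rw [← sum_add_distrib]
    exact sum_congr rfl fun y _ => by ring
  rw [h2] at h1
  refine h1.trans ?_
  rw [mul_sum]
  refine sum_le_sum fun x hx => ?_
  rw [← mul_sum, mul_comm]
  exact mul_le_mul_of_nonneg_right (hρ x hx) (sq_nonneg _)

/-- If the positive parts of `⟨x, y⟩ - a` have bounded row sums, then so do the squares of the
entries which are bounded away below `0`. -/
theorem NearPSD.low_row {B : Finset V} {a b ε F : ℝ} (h : NearPSD B a ε) (hε : 0 ≤ ε)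
    (hB : ∀ x ∈ B, ‖x‖ = 1) (ha : a < 1) (hba : b < a)
    (hF : ∀ x ∈ B, ∑ y ∈ B, max (inner ℝ x y - a) 0 ≤ (1 - a) * F) {z : V} (hz : z ∈ B) :
    (∑ x ∈ B with inner ℝ x z ≤ b, (inner ℝ x z - a) ^ 2) *
      (1 - ε * (1 - a) * (1 / (1 - a) + 1 / (a - b)) ^ 2) ≤ (1 - a) ^ 2 * F := by
  set L := {x ∈ B | inner ℝ x z ≤ b} with hL
  have hLB : L ⊆ B := filter_subset _ _
  set W := ∑ x ∈ L, (inner ℝ x z - a) ^ 2 with hW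
  have hκ : 0 < 1 - a := sub_pos.2 ha
  have hg : 0 < a - b := sub_pos.2 hba
  have hW0 : 0 ≤ W := sum_nonneg fun x _ => sq_nonneg _
  have hF0 : 0 ≤ F := by
    have h1 := hF z hz
    have h2 : 0 ≤ ∑ y ∈ B, max (inner ℝ z y - a) 0 := sum_nonneg fun y _ => le_max_right _ _
    exact nonneg_of_mul_nonneg_right (h2.trans h1) hκ
  -- The weight W/(1−a) at z is optimal: the terms involving z sum to −W²/(1−a), against at most
  -- (1−a)FW from `L` by Schur's test.
  have key := h.add_single hε hLB hz (hB z hz) (fun x => a - inner ℝ x z) (W / (1 - a))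
  have hgw : ∀ x ∈ L, a - b ≤ a - inner ℝ x z := fun x hx => by
    have := (mem_filter.1 hx).2
    linarith
  have e1 : ∑ x ∈ L, (a - inner ℝ x z) * (inner ℝ x z - a) = -W := by
    rw [hW, ← sum_neg_distrib]
    exact sum_congr rfl fun x _ => by ring
  have e2 : ∑ x ∈ L, |a - inner ℝ x z| ≤ W / (a - b) := by
    rw [le_div_iff₀ hg, hW, sum_mul]
    refine sum_le_sum fun x hx => ?_
    have := hgw x hx
    rw [abs_of_nonneg (by linarith)]
    nlinarith
  have e3 : ∑ x ∈ L, ∑ y ∈ L, (a - inner ℝ x z) * (a - inner ℝ y z) * (inner ℝ x y - a) ≤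
      (1 - a) * F * W := by
    have h1 := sum_mul_mul_le_of_row L (fun x y => max (inner ℝ x y - a) 0)
      (fun x => a - inner ℝ x z) (ρ := (1 - a) * F) (fun x _ y _ => le_max_right _ _)
      (fun x y => by rw [real_inner_comm]) (fun x hx => le_trans
        (sum_le_sum_of_subset_of_nonneg hLB fun y _ _ => le_max_right _ _) (hF x (hLB hx)))
    have h2 : ∑ x ∈ L, (a - inner ℝ x z) ^ 2 = W :=
      sum_congr rfl fun x _ => by ring
    rw [h2] at h1
    refine le_trans (sum_le_sum fun x hx => sum_le_sum fun y hy => ?_) h1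
    have := hgw x hx
    have := hgw y hy
    exact mul_le_mul_of_nonneg_left (le_max_left _ _)
      (mul_nonneg (by linarith) (by linarith))
  have e4 : |W / (1 - a)| = W / (1 - a) := abs_of_nonneg (div_nonneg hW0 hκ.le)
  have e5 : ε * (∑ x ∈ L, |a - inner ℝ x z| + W / (1 - a)) ^ 2 ≤
      ε * (W / (a - b) + W / (1 - a)) ^ 2 := by
    have : 0 ≤ ∑ x ∈ L, |a - inner ℝ x z| := sum_nonneg fun x _ => abs_nonneg _
    have : 0 ≤ W / (1 - a) := div_nonneg hW0 hκ.le
    gcongr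
  rw [e1, e4] at key
  have e6 : 2 * (W / (1 - a)) * -W + (W / (1 - a)) ^ 2 * (1 - a) = -(W * (W / (1 - a))) := by
    field_simp
    ring
  have e7 : W * (W / (1 - a)) ≤ (1 - a) * F * W + ε * (W / (a - b) + W / (1 - a)) ^ 2 := by
    linarith
  rcases hW0.eq_or_lt with h0 | hpos
  · rw [← h0, zero_mul]
    positivity
  refine le_of_mul_le_mul_left ?_ (div_pos hpos hκ)
  have e8 : W / (1 - a) * (W * (1 - ε * (1 - a) * (1 / (1 - a) + 1 / (a - b)) ^ 2)) =
      W * (W / (1 - a)) - ε * (W / (a - b) + W / (1 - a)) ^ 2 := by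
    field_simp
    ring
  have e9 : W / (1 - a) * ((1 - a) ^ 2 * F) = (1 - a) * F * W := by
    field_simp
  rw [e8, e9]
  linarith

/-- In each row the high entries lie in [0, 1−a], so their squares sum to at most (1−a)²F; the low
ones give (1−a)²F/θ by `NearPSD.low_row`. As ε → 0 the factor 1 + 1/θ tends to 2, the source of the
powers of 2. -/
theorem NearPSD.card_le_of_row {n : ℕ} {B : Finset (EuclideanSpace ℝ (Fin n))} {a b ε F : ℝ}
    (h : NearPSD B a ε) (hε : 0 ≤ ε) (hne : B.Nonempty) (hB : ∀ x ∈ B, ‖x‖ = 1) (ha : a < 1)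
    (hba : b < a)
    (hab : ∀ x ∈ B, ∀ y ∈ B, x ≠ y → a ≤ inner ℝ x y ∨ inner ℝ x y ≤ b)
    (hF : ∀ x ∈ B, ∑ y ∈ B, max (inner ℝ x y - a) 0 ≤ (1 - a) * F)
    (hθ : 0 < 1 - ε * (1 - a) * (1 / (1 - a) + 1 / (a - b)) ^ 2) :
    (#B : ℝ) ≤ (n + 1) * (F * (1 + 1 / (1 - ε * (1 - a) * (1 / (1 - a) + 1 / (a - b)) ^ 2))) := by
  have hκ : 0 < 1 - a := sub_pos.2 ha
  set θ := 1 - ε * (1 - a) * (1 / (1 - a) + 1 / (a - b)) ^ 2 with hθdef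
  have hrow : ∀ x ∈ B, ∑ y ∈ B, (inner ℝ x y - a) ^ 2 ≤ (1 - a) ^ 2 * (F * (1 + 1 / θ)) := by
    intro x hx
    have h1 : ∑ y ∈ B with inner ℝ y x ≤ b, (inner ℝ y x - a) ^ 2 ≤ (1 - a) ^ 2 * F / θ := by
      rw [le_div_iff₀ hθ]
      exact h.low_row hε hB ha hba hF hx
    have h2 : ∑ y ∈ B with ¬ inner ℝ y x ≤ b, (inner ℝ y x - a) ^ 2 ≤ (1 - a) * ((1 - a) * F) := by
      calc _ ≤ ∑ y ∈ B with ¬ inner ℝ y x ≤ b, (1 - a) * max (inner ℝ x y - a) 0 := by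
            refine sum_le_sum fun y hy => ?_
            rw [mem_filter] at hy
            rw [real_inner_comm]
            have hle : inner ℝ x y ≤ 1 := inner_le_one (hB x hx) (hB y hy.1)
            have hge : a ≤ inner ℝ x y := by
              by_cases hxy : x = y
              · subst hxy
                rw [real_inner_self_eq_norm_sq, hB x hx]
                linarith
              · refine (hab x hx y hy.1 hxy).resolve_right ?_
                rw [real_inner_comm]
                exact hy.2
            rw [max_eq_left (by linarith)]
            nlinarith
        _ ≤ ∑ y ∈ B, (1 - a) * max (inner ℝ x y - a) 0 :=
            sum_le_sum_of_subset_of_nonneg (filter_subset _ _)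
              fun y _ _ => mul_nonneg hκ.le (le_max_right _ _)
        _ ≤ _ := by
            rw [← mul_sum]
            exact mul_le_mul_of_nonneg_left (hF x hx) hκ.le
    have h3 := sum_filter_add_sum_filter_not B (fun y => inner ℝ y x ≤ b)
      (fun y => (inner ℝ y x - a) ^ 2)
    have h4 : ∑ y ∈ B, (inner ℝ x y - a) ^ 2 = ∑ y ∈ B, (inner ℝ y x - a) ^ 2 :=
      sum_congr rfl fun y _ => by rw [real_inner_comm]
    have h5 : (1 - a) ^ 2 * (F * (1 + 1 / θ)) =
      (1 - a) ^ 2 * F / θ + (1 - a) * ((1 - a) * F) := by ring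
    linarith
  have h1 := card_sq_le_of_gram hB a
  have h2 : ∑ x ∈ B, ∑ y ∈ B, (inner ℝ x y - a) ^ 2 ≤
      #B * ((1 - a) ^ 2 * (F * (1 + 1 / θ))) := by
    simpa using sum_le_card_nsmul B _ _ hrow
  have hc : (0 : ℝ) < #B := by exact_mod_cast hne.card_pos
  have h3 : ((1 - a) ^ 2 * #B) * #B ≤
      ((1 - a) ^ 2 * #B) * ((n + 1) * (F * (1 + 1 / θ))) := by
    calc _ = ((1 - a) * #B) ^ 2 := by ring
      _ ≤ _ := h1
      _ ≤ (n + 1) * (#B * ((1 - a) ^ 2 * (F * (1 + 1 / θ)))) := by gcongr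
      _ = _ := by ring
  exact le_of_mul_le_mul_left h3 (by positivity)

/-! ### Asymptotic bounds -/

/-- Up to an error `o(nʳ)`, codes that are almost positive semidefinite after the shift by `c` have
size at most `C * nʳ`. -/
def CodeBound (A : Finset ℝ) (b c C : ℝ) (r : ℕ) : Prop :=
  ∀ δ > 0, ∃ ε > 0, ∃ n₀ : ℕ, ∀ n ≥ n₀, ∀ B : Finset (EuclideanSpace ℝ (Fin n)),
    IsCode B A b → NearPSD B c ε → (#B : ℝ) ≤ (C + δ) * (n : ℝ) ^ r

/-- Up to an error `o(nʳ)`, the positive parts of `(⟨x, y⟩ - a) / (1 - a)` have row sums at most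
`C * nʳ`. -/
def RowBound (A : Finset ℝ) (b a C : ℝ) (r : ℕ) : Prop :=
  ∀ δ > 0, ∃ ε > 0, ∃ n₀ : ℕ, ∀ n ≥ n₀, ∀ B : Finset (EuclideanSpace ℝ (Fin n)),
    IsCode B (insert a A) b → NearPSD B a ε →
      ∀ x ∈ B, ∑ y ∈ B, max (inner ℝ x y - a) 0 ≤ (1 - a) * ((C + δ) * (n : ℝ) ^ r)

theorem RowBound.codeBound {A : Finset ℝ} {a b C : ℝ} {r : ℕ} (h : RowBound A b a C r)
    (hC : 0 ≤ C) (hA : ∀ v ∈ A, a < v) (ha : a < 1) (hba : b < a) :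
    CodeBound (insert a A) b a (2 * C) (r + 1) := by
  intro δ hδ
  -- Chosen so that (1+δ₁)(C+δ₁)(2+δ₁) ≤ 2C + δ.
  set δ₁ := min 1 (δ / (4 * C + 6)) with hδ₁
  have hδ1 : δ₁ ≤ 1 := min_le_left _ _
  have hδ2 : δ₁ * (4 * C + 6) ≤ δ := (le_div_iff₀ (by positivity)).1 (min_le_right _ _)
  have hδ0 : 0 < δ₁ := lt_min one_pos (by positivity)
  obtain ⟨ε₁, hε₁, n₁, h1⟩ := h δ₁ hδ0
  have hκ : 0 < 1 - a := sub_pos.2 ha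
  have hg : 0 < a - b := sub_pos.2 hba
  set c₀ := (1 - a) * (1 / (1 - a) + 1 / (a - b)) ^ 2 with hc₀
  have hc0 : 0 < c₀ := by positivity
  obtain ⟨n₂, hn₂⟩ := exists_nat_gt (1 / δ₁)
  refine ⟨min ε₁ (δ₁ / (2 * c₀)), lt_min hε₁ (by positivity), max n₁ n₂, ?_⟩
  intro n hn B hB hP
  rcases B.eq_empty_or_nonempty with rfl | hne
  · simp only [card_empty, Nat.cast_zero]
    positivity
  have hF := h1 n (le_trans (le_max_left _ _) hn) B hB (hP.mono_error (min_le_left _ _))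
  set ε := δ₁ / (2 * c₀) with hε
  have hεc : ε * c₀ = δ₁ / 2 := by rw [hε]; field_simp
  have hθ : 1 - ε * (1 - a) * (1 / (1 - a) + 1 / (a - b)) ^ 2 = 1 - δ₁ / 2 := by
    rw [mul_assoc, ← hc₀, hεc]
  have key := (hP.mono_error (min_le_right _ _)).card_le_of_row (by positivity) hne hB.1 ha hba
    (fun x hx y hy hxy => (hB.2 x hx y hy hxy).imp_left fun h => by
      rcases mem_insert.1 h with h | h
      · exact h.ge
      · exact (hA _ h).le) hF (by rw [hθ]; linarith)
  rw [hθ] at key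
  have hinv : 1 / (1 - δ₁ / 2) ≤ 1 + δ₁ := by
    rw [div_le_iff₀ (by linarith)]
    nlinarith
  have hn1 : 1 ≤ δ₁ * n := by
    have h2 : 1 / δ₁ < n := hn₂.trans_le (by exact_mod_cast le_trans (le_max_right _ _) hn)
    rw [div_lt_iff₀ hδ0] at h2
    linarith
  calc (#B : ℝ) ≤ (n + 1) * ((C + δ₁) * n ^ r * (1 + 1 / (1 - δ₁ / 2))) := key
    _ ≤ ((1 + δ₁) * n) * ((C + δ₁) * n ^ r * (1 + (1 + δ₁))) := by
        have hpos : 0 < 1 - δ₁ / 2 := by linarith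
        have := one_div_pos.2 hpos
        gcongr
        linarith
    _ = ((1 + δ₁) * (C + δ₁) * (2 + δ₁)) * n ^ (r + 1) := by ring
    _ ≤ (2 * C + δ) * n ^ (r + 1) := by
        gcongr
        have e1 : δ₁ * δ₁ ≤ δ₁ * 1 := by gcongr
        have e2 : (1 + δ₁) * (2 + δ₁) ≤ 2 + 4 * δ₁ := by nlinarith
        have e3 : (C + δ₁) * ((1 + δ₁) * (2 + δ₁)) ≤ (C + δ₁) * (2 + 4 * δ₁) := by gcongr
        nlinarith

theorem IsCode.row_le {V : Type*} [NormedAddCommGroup V] [InnerProductSpace ℝ V] {B : Finset V}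
    {A : Finset ℝ} {a b : ℝ} (hB : IsCode B (insert a A) b) (hA : ∀ v ∈ A, a < v) (ha : a < 1)
    (hba : b < a) {x : V} (hx : x ∈ B) :
    ∑ y ∈ B, max (inner ℝ x y - a) 0 ≤
      1 - a + ∑ v ∈ A, (v - a) * #{y ∈ B | inner ℝ y x = v} := by
  have h1 : ∑ v ∈ A, (v - a) * (#{y ∈ B | inner ℝ y x = v} : ℝ) =
      ∑ y ∈ B, ∑ v ∈ A, if inner ℝ y x = v then v - a else 0 := by
    rw [sum_comm]
    refine sum_congr rfl fun v _ => ?_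
    rw [← sum_filter, sum_const, nsmul_eq_mul, mul_comm]
  have h0 : ∀ y, 0 ≤ ∑ v ∈ A, if inner ℝ y x = v then v - a else 0 := fun y =>
    sum_nonneg fun v hv => by
      split_ifs
      · exact (sub_pos.2 (hA v hv)).le
      · exact le_rfl
  rw [h1, ← add_sum_erase B _ hx, real_inner_self_eq_norm_sq, hB.1 x hx, one_pow,
    max_eq_left (by linarith)]
  gcongr 1
  rw [← add_sum_erase B (fun y => ∑ v ∈ A, if inner ℝ y x = v then v - a else 0) hx]
  refine le_add_of_nonneg_of_le (h0 x) (sum_le_sum fun y hy => max_le ?_ (h0 y))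
  rcases hB.2 x hx y (mem_of_mem_erase hy) (ne_of_mem_erase hy).symm with h | h
  · rcases mem_insert.1 h with h | h
    · rw [h, sub_self]
      exact h0 y
    · rw [real_inner_comm] at h ⊢
      rw [sum_ite_eq, if_pos h]
  · exact le_trans (by linarith) (h0 y)

theorem rowBound_empty {a b : ℝ} (ha : a < 1) (hba : b < a) : RowBound ∅ b a 1 0 := by
  intro δ hδ
  refine ⟨1, one_pos, 0, fun n _ B hB _ x hx => ?_⟩
  refine (hB.row_le (by simp) ha hba hx).trans ?_
  have : 0 < 1 - a := sub_pos.2 ha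
  simp only [sum_empty, pow_zero, mul_one, add_zero]
  nlinarith

theorem exists_uniform_of_forall_mem {A : Finset ℝ} (P : ℝ → ℝ → ℕ → Prop)
    (hmono : ∀ v ε ε' n n', P v ε n → ε' ≤ ε → n ≤ n' → P v ε' n')
    (h : ∀ v ∈ A, ∃ ε > 0, ∃ n, P v ε n) : ∃ ε > 0, ∃ n, ∀ v ∈ A, P v ε n := by
  induction A using Finset.induction_on with
  | empty => exact ⟨1, one_pos, 0, by simp⟩
  | insert v A _ ih =>
    obtain ⟨ε, hε, n, h1⟩ := ih fun v hv => h v (mem_insert_of_mem hv)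
    obtain ⟨ε', hε', n', h2⟩ := h v (mem_insert_self v A)
    refine ⟨min ε ε', lt_min hε hε', max n n', fun u hu => ?_⟩
    rcases mem_insert.1 hu with rfl | hu
    · exact hmono _ _ _ _ _ h2 (min_le_right _ _) (le_max_right _ _)
    · exact hmono _ _ _ _ _ (h1 u hu) (min_le_left _ _) (le_max_left _ _)

/-- Codes with inner products in `A` above `a` obey the sharp bound with constant `G`. -/
def UpperBound (A : Finset ℝ) (a G : ℝ) (r : ℕ) : Prop :=
  ∀ a₂ ∈ A, (∀ v ∈ A, a₂ ≤ v) → ∀ c, a < c → c ≤ a₂ →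
    CodeBound A a c (G * (1 + (a₂ - c) / (c - a))) r

/-- The neighbours of x at product v form a code in which a acts as the low threshold, with shift c
supplied by `NearPSD.link`. The inductive factor (a₂−a)/(c−a) is offset by the weight v − a: their
product is at most 1 − a, so each v costs at most about (1−a)·G·nʳ⁺¹. -/
theorem UpperBound.rowBound {A : Finset ℝ} {a b G : ℝ} {r : ℕ} (h : UpperBound A a G (r + 1))
    (hA : ∀ v ∈ A, a < v) (hA1 : ∀ v ∈ A, v < 1) (ha : a < 1) (hba : b < a) (hG : 0 ≤ G) :
    RowBound A b a (#A * G) (r + 1) := by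
  intro δ hδ
  have hκ : 0 < 1 - a := sub_pos.2 ha
  set δ₁ := δ / (2 * (#A + 1)) with hδ₁
  have hδ1 : 0 < δ₁ := by positivity
  obtain ⟨ε, hε, n₁, h1⟩ := exists_uniform_of_forall_mem (A := A)
    (fun v ε n₀ => ∀ n ≥ n₀, ∀ B : Finset (EuclideanSpace ℝ (Fin n)), IsCode B (insert a A) b →
      NearPSD B a ε → ∀ x ∈ B, (v - a) * (#{y ∈ B | inner ℝ y x = v} : ℝ) ≤
        (1 - a) * ((G + δ₁) * (n : ℝ) ^ (r + 1)))
    (fun v ε ε' n n' h hε hn m hm B hB hP => h m (hn.trans hm) B hB (hP.mono_error hε)) (by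
      intro v hv
      have hne : A.Nonempty := ⟨v, hv⟩
      set a₂ := A.min' hne with ha₂
      have ha₂A : a₂ ∈ A := A.min'_mem hne
      have ha₂v : a₂ ≤ v := A.min'_le v hv
      have hav := hA v hv
      have haa₂ := hA a₂ ha₂A
      have hv1 := hA1 v hv
      -- Truncated because `UpperBound` requires c ≤ a₂; lowering the shift is harmless.
      set c := min (a + (v - a) ^ 2 / (1 - a)) a₂ with hc
      have hac : a < c := lt_min (lt_add_of_pos_right _ (by
        have := sub_pos.2 hav
        positivity)) haa₂
      obtain ⟨ε, hε, n₁, h1⟩ := h a₂ ha₂A (fun u hu => A.min'_le u hu) c hac (min_le_right _ _)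
        δ₁ hδ1
      refine ⟨ε / 4, by positivity, n₁, fun n hn B hB hP x hx => ?_⟩
      have hRB : {y ∈ B | inner ℝ y x = v} ⊆ B := filter_subset _ _
      have hR := h1 n hn {y ∈ B | inner ℝ y x = v} ((hB.subset hRB).of_insert hba.le) (by
        have := hP.link (by positivity) hRB hx (hB.1 x hx) (fun y hy => (mem_filter.1 hy).2)
          hav.le hv1.le ha
        refine (this.mono_shift (min_le_left _ _)).mono_error ?_
        linarith)
      have hca : 0 < c - a := sub_pos.2 hac
      have hva : 0 < v - a := sub_pos.2 hav
      have hp : (v - a) * (1 + (a₂ - c) / (c - a)) ≤ 1 - a := by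
        have e1 : 1 + (a₂ - c) / (c - a) = (a₂ - a) / (c - a) := by field_simp; ring
        rw [e1, ← mul_div_assoc, div_le_iff₀ hca]
        rcases min_choice (a + (v - a) ^ 2 / (1 - a)) a₂ with h | h
        · have e2 : (1 - a) * (c - a) = (v - a) ^ 2 := by
            rw [hc, h]; field_simp; ring
          rw [e2]
          nlinarith
        · rw [hc, h]
          have : 0 < a₂ - a := sub_pos.2 haa₂
          nlinarith
      calc (v - a) * (#{y ∈ B | inner ℝ y x = v} : ℝ)
          ≤ (v - a) * ((G * (1 + (a₂ - c) / (c - a)) + δ₁) * (n : ℝ) ^ (r + 1)) := by gcongr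
        _ = (G * ((v - a) * (1 + (a₂ - c) / (c - a))) + (v - a) * δ₁) * (n : ℝ) ^ (r + 1) := by
            ring
        _ ≤ (G * (1 - a) + (1 - a) * δ₁) * (n : ℝ) ^ (r + 1) := by gcongr
        _ = _ := by ring)
  obtain ⟨n₂, hn₂⟩ := exists_nat_gt (2 / δ)
  refine ⟨ε, hε, max 1 (max n₁ n₂), fun n hn B hB hP x hx => ?_⟩
  have hn1 : 1 ≤ n := (le_max_left _ _).trans hn
  have hnn₁ : n₁ ≤ n := ((le_max_left _ _).trans (le_max_right _ _)).trans hn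
  have hnn₂ : n₂ ≤ n := ((le_max_right _ _).trans (le_max_right _ _)).trans hn
  have hpow : 1 ≤ δ / 2 * (n : ℝ) ^ (r + 1) := by
    have h2 : 2 / δ < n := hn₂.trans_le (by exact_mod_cast hnn₂)
    rw [div_lt_iff₀ hδ] at h2
    have h3 : (n : ℝ) ≤ (n : ℝ) ^ (r + 1) := by
      have := Nat.le_self_pow (Nat.succ_ne_zero r) n
      exact_mod_cast this
    nlinarith
  refine (hB.row_le hA ha hba hx).trans ?_
  have h2 := sum_le_card_nsmul A _ _ fun v hv => h1 v hv n hnn₁ B hB hP x hx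
  rw [nsmul_eq_mul] at h2
  have h3 : (#A : ℝ) * δ₁ ≤ δ / 2 := by
    rw [hδ₁, mul_div_assoc', div_le_div_iff₀ (by positivity) (by positivity)]
    nlinarith
  calc _ ≤ (1 - a) * (δ / 2 * (n : ℝ) ^ (r + 1)) +
        #A * ((1 - a) * ((G + δ₁) * (n : ℝ) ^ (r + 1))) := by
        refine add_le_add ?_ h2
        nlinarith
    _ = (1 - a) * ((#A * G + (#A * δ₁ + δ / 2)) * (n : ℝ) ^ (r + 1)) := by ring
    _ ≤ _ := by
        gcongr
        linarith

/-- A code without large cliques at its smallest positive inner product `a` is small. -/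
theorem UpperBound.exists_card_le_of_no_clique {A : Finset ℝ} {a b c G : ℝ} {r : ℕ}
    (h : UpperBound A a G r) (hA : ∀ v ∈ A, a < v) (hA1 : ∀ v ∈ A, v < 1)
    (ha0 : 0 ≤ a) (ha : a < 1) (hbc : b < c) (hca : c ≤ a) (hG : 0 ≤ G) (m : ℕ) :
    ∃ ε > 0, ∃ K : ℝ, 0 ≤ K ∧ ∃ n₀ : ℕ, ∀ n ≥ n₀, ∀ B : Finset (EuclideanSpace ℝ (Fin n)),
      IsCode B (insert a A) b → NearPSD B c ε → (∀ S ⊆ B, IsEquiangular S a → #S ≠ m) →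
      (#B : ℝ) ≤ K * (n : ℝ) ^ r := by
  obtain ⟨ε₁, hε₁, C, hC, n₁, h1⟩ : ∃ ε > 0, ∃ C : ℝ, 0 ≤ C ∧ ∃ n₁ : ℕ, ∀ n ≥ n₁,
      ∀ B : Finset (EuclideanSpace ℝ (Fin n)), IsCode B A a → ∀ v ∈ A, NearPSD B v ε →
        (#B : ℝ) ≤ C * (n : ℝ) ^ r := by
    rcases A.eq_empty_or_nonempty with rfl | hne
    · exact ⟨1, one_pos, 0, le_rfl, 0, by simp⟩
    · obtain ⟨ε, hε, n₁, h1⟩ := h _ (A.min'_mem hne) (fun u hu => A.min'_le u hu) _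
        (hA _ (A.min'_mem hne)) le_rfl 1 one_pos
      exact ⟨ε, hε, _, by simp; positivity, n₁, fun n hn B hB v hv hP =>
        h1 n hn B hB (hP.mono_shift (A.min'_le v hv))⟩
  have hg : 0 < c - b := sub_pos.2 hbc
  obtain ⟨m₁, hm₁⟩ := exists_nat_gt (3 / ε₁)
  obtain ⟨m₂, hm₂⟩ := exists_nat_gt (2 * (1 - c + (c - b)) / (c - b))
  -- An `M`-clique at a contains an excluded one, an `M`-clique below b contradicts positivity, and
  -- one at v in `A` leaves error 3/M ≤ ε₁ on its joined set.
  set M := max (m + 1) (max m₁ m₂) with hM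
  have hM0 : 0 < M := lt_of_lt_of_le (Nat.succ_pos m) (le_max_left _ _)
  have hM0' : (0 : ℝ) < M := by exact_mod_cast hM0
  have hM1 : 3 * (1 / (M : ℝ)) ≤ ε₁ := by
    have : 3 / ε₁ < M := hm₁.trans_le (by
      exact_mod_cast (le_max_left _ _).trans (le_max_right _ _))
    rw [div_lt_iff₀ hε₁] at this
    rw [← mul_div_assoc, mul_one, div_le_iff₀ hM0']
    linarith
  have hM2 : 1 - c + (c - b) < (c - b) / 2 * M := by
    have : 2 * (1 - c + (c - b)) / (c - b) < M := hm₂.trans_le (by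
      exact_mod_cast (le_max_right _ _).trans (le_max_right _ _))
    rw [div_lt_iff₀ hg] at this
    linarith
  obtain ⟨K, hK, hR⟩ := IsCode.exists_clique (#A + 1) M
  refine ⟨(c - b) / 2, by positivity, max K (K * C), by positivity, max 1 n₁, ?_⟩
  intro n hn B hB hP hno
  have hn1 : (1 : ℝ) ≤ n := by exact_mod_cast (le_max_left _ _).trans hn
  by_cases hKB : K ≤ #B
  swap
  · calc (#B : ℝ) ≤ K := by exact_mod_cast (not_le.1 hKB).le
      _ = K * 1 := (mul_one _).symm
      _ ≤ max (K : ℝ) (K * C) * (n : ℝ) ^ r := by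
        gcongr
        · exact le_max_left _ _
        · exact one_le_pow₀ hn1
  rcases hR B (insert a A) b (card_insert_le _ _) hB hKB with
    ⟨S, hS, hSc, hlow⟩ | ⟨v, hv, S, hS, R, hRB, hSc, hBR, hSv, hjoin⟩
  · exfalso
    have := hP.low_clique hS (card_pos.1 (hSc ▸ hM0)) hB.1 hlow
    rw [hSc] at this
    linarith
  · rcases mem_insert.1 hv with rfl | hv
    · exfalso
      obtain ⟨S', hS', hSc'⟩ := exists_subset_card_eq (s := S) (n := m) (by
        rw [hSc]
        exact (Nat.le_succ m).trans (le_max_left _ _))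
      exact hno S' (hS'.trans hS) (hSv.subset hS') hSc'
    · have hSne : S.Nonempty := card_pos.1 (hSc ▸ hM0)
      have hPR : NearPSD R v (3 * (1 / M)) := by
        refine NearPSD.of_near_center (s := avg S) (fun x hx => ?_) ?_
        · rw [inner_avg_eq hSne fun y hy => (hjoin x hx y hy).2, sub_self, abs_zero]
          positivity
        · have hv1 := hA1 v hv
          have hv0 := hA v hv
          rw [hSv.norm_avg_sq hSne, hSc, add_sub_cancel_left,
            abs_of_nonneg (div_nonneg (by linarith) hM0'.le)]
          gcongr
          linarith
      have hRc := h1 n ((le_max_right _ _).trans hn) R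
        ((hB.subset hRB).of_insert (hbc.le.trans hca)) v hv (hPR.mono_error hM1)
      calc (#B : ℝ) ≤ K * #R := by exact_mod_cast hBR
        _ ≤ K * (C * (n : ℝ) ^ r) := by gcongr
        _ = K * C * (n : ℝ) ^ r := by ring
        _ ≤ _ := by
          gcongr
          exact le_max_right _ _

/-! ### Decomposition into clusters -/

theorem IsEquiangular.norm_avg_sq_le {S : Finset V} {a : ℝ} {m : ℕ} (h : IsEquiangular S a)
    (ha0 : 0 ≤ a) (hm : 0 < m) (hS : m ≤ #S) : ‖avg S‖ ^ 2 ≤ a + 1 / m := by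
  rw [h.norm_avg_sq (card_pos.1 (hm.trans_le hS))]
  have : (0 : ℝ) < m := by exact_mod_cast hm
  have : (m : ℝ) ≤ #S := by exact_mod_cast hS
  gcongr
  linarith

/-- Both barycentres have squared norm at most a + 1/m, so their product is at most that as well. -/
theorem IsEquiangular.not_high_of_le_card {S T : Finset V} {a g : ℝ} {m : ℕ}
    (hS : IsEquiangular S a) (hT : IsEquiangular T a) (ha0 : 0 ≤ a) (hm : 0 < m)
    (hmS : m ≤ #S) (hmT : m ≤ #T) (hg : 1 / (m : ℝ) < g) :
    ¬ ∀ x ∈ T, ∀ y ∈ S, a + g ≤ inner ℝ x y := by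
  intro h
  have h1 : a + g ≤ inner ℝ (avg S) (avg T) := by
    refine le_inner_avg (card_pos.1 (hm.trans_le hmT)) fun x hx => ?_
    rw [real_inner_comm]
    exact le_inner_avg (card_pos.1 (hm.trans_le hmS)) (h x hx)
  have h2 : 0 ≤ ‖avg S - avg T‖ ^ 2 := sq_nonneg _
  rw [norm_sub_sq_real] at h2
  have := hS.norm_avg_sq_le ha0 hm hmS
  have := hT.norm_avg_sq_le ha0 hm hmT
  linarith

/-- The squared norm of avg L + avg T − 2·avg E would be at most 2(b − a) + 6/m < 0. -/
theorem IsEquiangular.not_mixed_of_le_card {E L T : Finset V} {a b : ℝ} {m : ℕ}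
    (hE : IsEquiangular E a) (hL : IsEquiangular L a) (hT : IsEquiangular T a)
    (ha0 : 0 ≤ a) (hm : 0 < m) (hmE : m ≤ #E) (hmL : m ≤ #L) (hmT : m ≤ #T)
    (hmb : 3 / (m : ℝ) < a - b) (hEL : ∀ x ∈ E, ∀ y ∈ L, inner ℝ x y = a)
    (hTE : ∀ x ∈ T, ∀ y ∈ E, inner ℝ x y = a) : ¬ ∀ x ∈ T, ∀ y ∈ L, inner ℝ x y ≤ b := by
  intro h
  have hEne := card_pos.1 (hm.trans_le hmE)
  have hLne := card_pos.1 (hm.trans_le hmL)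
  have hTne := card_pos.1 (hm.trans_le hmT)
  have h1 : inner ℝ (avg L) (avg T) ≤ b := by
    refine inner_avg_le hTne fun x hx => ?_
    rw [real_inner_comm]
    exact inner_avg_le hLne (h x hx)
  have h2 : inner ℝ (avg E) (avg T) = a := by
    refine inner_avg_eq hTne fun x hx => ?_
    rw [real_inner_comm]
    exact inner_avg_eq hEne (hTE x hx)
  have h3 : inner ℝ (avg L) (avg E) = a := by
    refine inner_avg_eq hEne fun x hx => ?_
    rw [real_inner_comm]
    exact inner_avg_eq hLne (hEL x hx)
  have h4 : 0 ≤ ‖avg L + avg T - (2 : ℝ) • avg E‖ ^ 2 := sq_nonneg _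
  rw [norm_sub_sq_real, norm_add_sq_real, real_inner_smul_right, inner_add_left,
    real_inner_comm (avg E) (avg T), h2, h3, norm_smul, mul_pow, Real.norm_ofNat] at h4
  have := hE.norm_avg_sq_le ha0 hm hmE
  have := hL.norm_avg_sq_le ha0 hm hmL
  have := hT.norm_avg_sq_le ha0 hm hmT
  have e : 3 / (m : ℝ) = 3 * (1 / m) := by ring
  linarith

/-- `p` cliques of size `t` at inner product `a` with mutual inner products at most `b`. -/
structure IsCliqueSystem (B : Finset V) (a b : ℝ) (t p : ℕ) (S : Fin p → Finset V) : Prop where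
  subset : ∀ i, S i ⊆ B
  equiangular : ∀ i, IsEquiangular (S i) a
  card : ∀ i, #(S i) = t
  inner_le : ∀ i j, i ≠ j → ∀ x ∈ S i, ∀ y ∈ S j, inner ℝ x y ≤ b

/-- Constant weights on the union: each row has t − 1 off-diagonal products a and (p−1)t products at
most b. For small ε and large t this makes p at most about 1 + (a−c)/(c−b). -/
theorem IsCliqueSystem.mul_le {B : Finset V} {a b c ε : ℝ} {t p : ℕ} {S : Fin p → Finset V}
    (h : IsCliqueSystem B a b t p S) (hP : NearPSD B c ε) (hbc : b < c) (hca : c ≤ a)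
    (ha : a < 1) (ht : 0 < t) : p * (c - b - ε) ≤ (a - c) + 1 / t * (1 - a) + (c - b) := by
  have ht' : (0 : ℝ) < t := by exact_mod_cast ht
  rcases Nat.eq_zero_or_pos p with rfl | hp
  · have : 0 ≤ 1 / (t : ℝ) * (1 - a) := mul_nonneg (by positivity) (by linarith)
    simp only [Nat.cast_zero, zero_mul]
    linarith
  have hp' : (0 : ℝ) < p := by exact_mod_cast hp
  have hdisj : ∀ i j, i ≠ j → Disjoint (S i) (S j) := by
    intro i j hij
    rw [Finset.disjoint_left]
    intro x hx hx'
    have := h.inner_le i j hij x hx x hx'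
    rw [real_inner_self_eq_norm_sq, (h.equiangular i).1 x hx] at this
    linarith
  set U := univ.biUnion S with hU
  have hUc : #U = p * t := by
    rw [hU, card_biUnion fun i _ j _ hij => hdisj i j hij]
    simp [h.card]
  have hUB : U ⊆ B := biUnion_subset.2 fun i _ => h.subset i
  have hUne : U.Nonempty := card_pos.1 (by rw [hUc]; positivity)
  have key := (hP.subset hUB).sum_nonneg_of_row hUne
    (ρ := (1 - c) + (t - 1) * (a - c) - (p * t - t) * (c - b)) (fun x hx => by
      obtain ⟨i, -, hi⟩ := mem_biUnion.1 hx
      have hSU : S i ⊆ U := subset_biUnion_of_mem S (mem_univ i)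
      have h0 : ∑ y ∈ (S i).erase x, (inner ℝ x y - c) = ((t - 1 : ℕ) : ℝ) * (a - c) := by
        rw [sum_congr rfl fun y hy => by
          rw [(h.equiangular i).2 x hi y (mem_of_mem_erase hy) (ne_of_mem_erase hy).symm],
          sum_const, card_erase_of_mem hi, h.card, nsmul_eq_mul]
      rw [← sum_sdiff hSU, ← add_sum_erase (S i) _ hi, real_inner_self_eq_norm_sq,
        (h.equiangular i).1 x hi, h0, Nat.cast_sub ht]
      have h1 : ∑ y ∈ U \ S i, (inner ℝ x y - c) ≤ #(U \ S i) • (b - c) := by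
        refine sum_le_card_nsmul _ _ _ fun y hy => ?_
        rw [mem_sdiff] at hy
        obtain ⟨j, -, hj⟩ := mem_biUnion.1 hy.1
        have hij : i ≠ j := fun h => hy.2 (h ▸ hj)
        linarith [h.inner_le i j hij x hi y hj]
      have hle : t ≤ p * t := Nat.le_mul_of_pos_left t hp
      rw [card_sdiff_of_subset hSU, hUc, h.card, nsmul_eq_mul, Nat.cast_sub hle] at h1
      push_cast at h1 ⊢
      linarith)
  rw [hUc] at key
  push_cast at key
  have e : (t : ℝ) * (p * (c - b - ε)) ≤ t * ((a - c) + 1 / t * (1 - a) + (c - b)) := by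
    have e1 : (t : ℝ) * (1 / t * (1 - a)) = 1 - a := by field_simp
    nlinarith
  exact le_of_mul_le_mul_left e ht'

/-- A clique whose points all see a clique system in the same way, and are not almost completely
joined to any of its members, extends the system, at the cost of shrinking the cliques. -/
theorem IsCliqueSystem.extend {B T : Finset V} {A : Finset ℝ} {a b : ℝ} {t t' p m : ℕ}
    {S : Fin p → Finset V} (h : IsCliqueSystem B a b t p S) (hB : IsCode B (insert a A) b)
    (ha0 : 0 ≤ a) (hm : 0 < m) (hmb : 3 / (m : ℝ) < a - b)
    (hmA : ∀ v ∈ A, 2 / (m : ℝ) ≤ v - a) (hTB : T ⊆ B) (hT : IsEquiangular T a)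
    (hTc : #T = t') (hmt : m ≤ t') (htt : t' + 2 * m ≤ t)
    (hsame : ∀ x ∈ T, ∀ y ∈ T, ∀ i, ∀ s ∈ S i, (inner ℝ x s = a → inner ℝ y s = a) ∧
      (inner ℝ x s ≤ b → inner ℝ y s ≤ b))
    (hbad : ∀ x ∈ T, ∀ i, 2 * m < #{s ∈ S i | inner ℝ x s ≠ a}) :
    ∃ S' : Fin (p + 1) → Finset V, IsCliqueSystem B a b t' (p + 1) S' := by
  have hm' : (0 : ℝ) < m := by exact_mod_cast hm
  have hba : b < a := by
    have : 0 < 3 / (m : ℝ) := by positivity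
    linarith
  obtain ⟨z, hz⟩ : T.Nonempty := card_pos.1 (by omega)
  -- Seen from `T`, fewer than m points of `S i` are high (`not_high_of_le_card`). As more than 2m
  -- products differ from a, over m are low, so fewer than m equal a (`not_mixed_of_le_card`). All
  -- the rest, at least t − 2m, are low.
  have hlow : ∀ i, ∃ L ⊆ S i, #L = t' ∧ ∀ x ∈ T, ∀ y ∈ L, inner ℝ x y ≤ b := by
    intro i
    have hTS : ∀ x ∈ T, ∀ s ∈ S i, x ≠ s := by
      rintro x hx s hs rfl
      have h1 : {s ∈ S i | inner ℝ x s ≠ a} ⊆ {x} := fun y hy => by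
        rw [mem_filter] at hy
        by_contra hne
        rw [mem_singleton] at hne
        exact hy.2 ((h.equiangular i).2 x hs y hy.1 (Ne.symm hne))
      have h2 := card_le_card h1
      rw [card_singleton] at h2
      have := hbad x hx i
      omega
    set E := {s ∈ S i | inner ℝ z s = a} with hE
    set N := {s ∈ S i | inner ℝ z s ≠ a} with hN
    set L := {s ∈ N | inner ℝ z s ≤ b} with hL
    set H := {s ∈ N | ¬ inner ℝ z s ≤ b} with hH
    have hNS : N ⊆ S i := filter_subset _ _
    have hES : E ⊆ S i := filter_subset _ _
    have hLS : L ⊆ S i := (filter_subset _ _).trans hNS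
    have hHS : H ⊆ S i := (filter_subset _ _).trans hNS
    have hc1 : #E + #N = t := by
      rw [← h.card i]
      exact card_filter_add_card_filter_not _
    have hc2 : #L + #H = #N := card_filter_add_card_filter_not _
    have hLb : ∀ x ∈ T, ∀ y ∈ L, inner ℝ x y ≤ b := fun x hx y hy =>
      (hsame z hz x hx i y (hLS hy)).2 (mem_filter.1 hy).2
    have hHm : #H < m := by
      by_contra! hcon
      refine ((h.equiangular i).subset hHS).not_high_of_le_card hT ha0 hm hcon
        (hTc ▸ hmt) (g := 2 / m) (by gcongr; norm_num) fun x hx y hy => ?_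
      rw [hH, mem_filter, hN, mem_filter] at hy
      have hne : inner ℝ x y ≠ a := fun e => hy.1.2 ((hsame x hx z hz i y hy.1.1).1 e)
      have hnb : ¬ inner ℝ x y ≤ b := fun e => hy.2 ((hsame x hx z hz i y hy.1.1).2 e)
      have hA := (hB.2 x (hTB hx) y (h.subset i hy.1.1) (hTS x hx y hy.1.1)).resolve_right hnb
      have := hmA _ ((mem_insert.1 hA).resolve_left hne)
      linarith
    have hN2 : 2 * m < #N := hbad z hz i
    have hEm : #E < m := by
      by_contra! hcon
      refine ((h.equiangular i).subset hES).not_mixed_of_le_card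
        ((h.equiangular i).subset hLS) hT ha0 hm hcon (by omega) (hTc ▸ hmt) hmb ?_ ?_ hLb
      · intro x hx y hy
        refine (h.equiangular i).2 x (hES hx) y (hLS hy) ?_
        rintro rfl
        rw [hL, mem_filter, hN, mem_filter] at hy
        exact hy.1.2 (mem_filter.1 hx).2
      · intro x hx y hy
        exact (hsame z hz x hx i y (hES hy)).1 (mem_filter.1 hy).2
    obtain ⟨L', hL', hLc⟩ := exists_subset_card_eq (s := L) (n := t') (by omega)
    exact ⟨L', hL'.trans hLS, hLc, fun x hx y hy => hLb x hx y (hL' hy)⟩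
  choose L hLS hLc hLb using hlow
  refine ⟨Fin.cons T L, ?_, ?_, ?_, ?_⟩
  · exact Fin.cases hTB fun i => (hLS i).trans (h.subset i)
  · exact Fin.cases hT fun i => (h.equiangular i).subset (hLS i)
  · exact Fin.cases hTc hLc
  · refine Fin.cases (Fin.cases (fun h => absurd rfl h) fun j _ => hLb j) fun i =>
      Fin.cases (fun _ x hx y hy => ?_) fun j hij x hx y hy => ?_
    · rw [real_inner_comm]
      exact hLb i y hy x hx
    · exact h.inner_le i j (fun e => hij (congrArg Fin.succ e)) x (hLS i hx) y (hLS j hy)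

/-- The points joined to all but few members of a large clique form a cluster. -/
theorem IsEquiangular.nearPSD_cluster {B S : Finset V} {a : ℝ} {m : ℕ} (hS : IsEquiangular S a)
    (hne : S.Nonempty) (ha0 : 0 ≤ a) (ha : a < 1) (hB : ∀ x ∈ B, ‖x‖ = 1) :
    NearPSD {x ∈ B | #{s ∈ S | inner ℝ x s ≠ a} ≤ 2 * m} a (3 * ((4 * m + 1) / #S)) := by
  have hc : (0 : ℝ) < #S := by exact_mod_cast hne.card_pos
  refine NearPSD.of_near_center (s := avg S) (fun x hx => ?_) ?_
  · rw [mem_filter] at hx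
    have e1 : inner ℝ x (avg S) - a = (∑ s ∈ S with inner ℝ x s ≠ a, (inner ℝ x s - a)) / #S := by
      have : ∑ s ∈ S with inner ℝ x s ≠ a, (inner ℝ x s - a) = ∑ s ∈ S, (inner ℝ x s - a) := by
        refine sum_subset (filter_subset _ _) fun s hs hs' => ?_
        rw [mem_filter, not_and, not_not] at hs'
        rw [hs' hs, sub_self]
      rw [this, inner_avg, sum_sub_distrib, sum_const, nsmul_eq_mul]
      field_simp
    rw [e1, abs_div, abs_of_pos hc]
    refine div_le_div_of_nonneg_right ?_ hc.le
    calc _ ≤ ∑ s ∈ S with inner ℝ x s ≠ a, |inner ℝ x s - a| := abs_sum_le_sum_abs _ _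
      _ ≤ #{s ∈ S | inner ℝ x s ≠ a} • (2 : ℝ) := by
        refine sum_le_card_nsmul _ _ _ fun s hs => ?_
        have h1 := inner_le_one (hB x hx.1) (hS.1 s (mem_filter.1 hs).1)
        have h2 := neg_one_le_inner (hB x hx.1) (hS.1 s (mem_filter.1 hs).1)
        rw [abs_le]
        constructor <;> linarith
      _ ≤ _ := by
        rw [nsmul_eq_mul]
        have : (#{s ∈ S | inner ℝ x s ≠ a} : ℝ) ≤ 2 * m := by exact_mod_cast hx.2
        linarith
  · rw [hS.norm_avg_sq hne, add_sub_cancel_left, abs_of_nonneg (div_nonneg (by linarith) hc.le)]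
    have : (0 : ℝ) ≤ m := m.cast_nonneg
    gcongr
    linarith

/-- All points outside the clusters of a non-extendable clique system fall into boundedly many
clique-free classes. -/
theorem IsCliqueSystem.card_le {B : Finset V} {A : Finset ℝ} {a b D Q : ℝ} {t t' p m : ℕ}
    {S : Fin p → Finset V} (h : IsCliqueSystem B a b t p S) (hB : IsCode B (insert a A) b)
    (ha0 : 0 ≤ a) (ha : a < 1) (hm : 0 < m) (hmb : 3 / (m : ℝ) < a - b)
    (hmA : ∀ v ∈ A, 2 / (m : ℝ) ≤ v - a) (hmt : m ≤ t') (htt : t' + 2 * m ≤ t)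
    (hmax : ¬ ∃ S' : Fin (p + 1) → Finset V, IsCliqueSystem B a b t' (p + 1) S')
    (hD : ∀ R ⊆ B, (∀ T ⊆ R, IsEquiangular T a → #T ≠ t') → (#R : ℝ) ≤ D)
    (hQ : ∀ R ⊆ B, NearPSD R a (3 * ((4 * m + 1) / t)) → (#R : ℝ) ≤ Q) :
    (#B : ℝ) ≤ p * Q + 4 ^ (p * t) * D := by
  set cl : Fin p → Finset V := fun i => {x ∈ B | #{s ∈ S i | inner ℝ x s ≠ a} ≤ 2 * m} with hcl
  set N := {x ∈ B | ∀ i, 2 * m < #{s ∈ S i | inner ℝ x s ≠ a}} with hN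
  have hNB : N ⊆ B := filter_subset _ _
  have hcover : B ⊆ univ.biUnion cl ∪ N := by
    intro x hx
    rw [mem_union, mem_biUnion]
    by_cases hxN : x ∈ N
    · exact Or.inr hxN
    · rw [hN, mem_filter, not_and] at hxN
      have := hxN hx
      push Not at this
      obtain ⟨i, hi⟩ := this
      exact Or.inl ⟨i, mem_univ i, mem_filter.2 ⟨hx, hi⟩⟩
  have hcli : ∀ i, (#(cl i) : ℝ) ≤ Q := fun i => by
    refine hQ _ (filter_subset _ _) ?_
    have := (h.equiangular i).nearPSD_cluster (m := m)
      (card_pos.1 (by rw [h.card]; omega)) ha0 ha hB.1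
    rwa [h.card] at this
  set U := univ.biUnion S with hU
  have hUc : #U ≤ p * t := by
    refine card_biUnion_le.trans ?_
    simp [h.card]
  -- A clique of size t' inside one type class outside the clusters would extend the system; there
  -- are at most 4^(pt) types.
  set ty : V → Finset V × Finset V := fun x =>
    ({s ∈ U | inner ℝ x s = a}, {s ∈ U | inner ℝ x s ≤ b}) with hty
  have hNc : (#N : ℝ) ≤ 4 ^ (p * t) * D := by
    have hD0 : 0 ≤ D := by
      have := hD ∅ (empty_subset _) fun T hT _ => by
        rw [subset_empty.1 hT, card_empty]
        omega
      simpa using this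
    have h1 : #N = ∑ q ∈ U.powerset ×ˢ U.powerset, #{x ∈ N | ty x = q} :=
      card_eq_sum_card_fiberwise fun x _ => mem_coe.2 (mem_product.2
        ⟨mem_powerset.2 (filter_subset _ _), mem_powerset.2 (filter_subset _ _)⟩)
    have h2 : ∀ q ∈ U.powerset ×ˢ U.powerset, (#{x ∈ N | ty x = q} : ℝ) ≤ D := by
      intro q _
      refine hD _ ((filter_subset _ _).trans hNB) fun T hT hTe hTc => hmax ?_
      have hTN : ∀ x ∈ T, x ∈ N ∧ ty x = q := fun x hx => mem_filter.1 (hT hx)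
      refine h.extend hB ha0 hm hmb hmA (fun x hx => hNB (hTN x hx).1) hTe hTc hmt htt ?_
        fun x hx => (mem_filter.1 (hTN x hx).1).2
      intro x hx y hy i s hs
      have hxy : ty x = ty y := (hTN x hx).2.trans (hTN y hy).2.symm
      have hsU : s ∈ U := mem_biUnion.2 ⟨i, mem_univ i, hs⟩
      have e1 := Finset.ext_iff.1 (congrArg Prod.fst hxy) s
      have e2 := Finset.ext_iff.1 (congrArg Prod.snd hxy) s
      simp only [hty, mem_filter, hsU, true_and] at e1 e2
      exact ⟨e1.1, e2.1⟩
    have h3 := sum_le_card_nsmul _ _ _ h2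
    rw [nsmul_eq_mul, card_product, card_powerset] at h3
    rw [h1]
    push_cast at h3 ⊢
    refine h3.trans ?_
    have e : (2 : ℝ) ^ #U * 2 ^ #U = 4 ^ #U := by rw [← mul_pow]; norm_num
    rw [e]
    gcongr
    norm_num
  have h4 : (#B : ℝ) ≤ #(univ.biUnion cl) + #N := by
    exact_mod_cast (card_le_card hcover).trans (card_union_le _ _)
  have h5 : (#(univ.biUnion cl) : ℝ) ≤ p * Q := by
    have h6 : (#(univ.biUnion cl) : ℝ) ≤ ∑ i, (#(cl i) : ℝ) := by exact_mod_cast card_biUnion_le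
    refine h6.trans ((sum_le_card_nsmul _ _ _ fun i _ => hcli i).trans_eq ?_)
    simp
  linarith

-- A non-extendable clique system has at most P + η members. Each cluster obeys the bound at shift
-- a, and the remaining points contribute only O(nʳ).
set_option maxHeartbeats 1600000 in
theorem UpperBound.codeBound {A : Finset ℝ} {a b c C G : ℝ} {r : ℕ} (hU : UpperBound A a G r)
    (hcl : CodeBound (insert a A) b a C (r + 1)) (hA : ∀ v ∈ A, a < v) (hA1 : ∀ v ∈ A, v < 1)
    (ha0 : 0 ≤ a) (ha : a < 1) (hbc : b < c) (hca : c ≤ a) (hG : 0 ≤ G) (hC : 0 ≤ C) :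
    CodeBound (insert a A) b c (C * (1 + (a - c) / (c - b))) (r + 1) := by
  intro δ hδ
  have hg : 0 < c - b := sub_pos.2 hbc
  have hba : b < a := hbc.trans_le hca
  set P := 1 + (a - c) / (c - b) with hP
  have hP1 : 1 ≤ P := le_add_of_nonneg_right (div_nonneg (sub_nonneg.2 hca) hg.le)
  have hPg : P * (c - b) = (a - c) + (c - b) := by rw [hP]; field_simp; ring
  set η := min 1 (δ / (4 * (C + 1))) with hη
  have hη0 : 0 < η := lt_min one_pos (by positivity)
  have hη1 : η ≤ 1 := min_le_left _ _
  have hηC : η * (4 * (C + 1)) ≤ δ := (le_div_iff₀ (by positivity)).1 (min_le_right _ _)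
  set δ₁ := δ / (4 * (P + 1)) with hδ₁
  have hδ1 : 0 < δ₁ := by positivity
  have hδP : δ₁ * (4 * (P + 1)) = δ := div_mul_cancel₀ _ (by positivity)
  have hPC : (P + η) * (C + δ₁) ≤ C * P + δ / 2 := by nlinarith
  obtain ⟨ε₁, hε₁, n₁, h1⟩ := hcl δ₁ hδ1
  obtain ⟨m, hm, hmb, hmA⟩ : ∃ m : ℕ, 0 < m ∧ 3 / (m : ℝ) < a - b ∧
      ∀ v ∈ A, 2 / (m : ℝ) ≤ v - a := by
    obtain ⟨M, hM⟩ := (A.image fun v => 2 / (v - a)).exists_le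
    obtain ⟨m, hm⟩ := exists_nat_gt (max M (3 / (a - b)))
    have hab : 0 < a - b := sub_pos.2 hba
    have hm1 : 3 / (a - b) < m := (le_max_right _ _).trans_lt hm
    have hm0 : (0 : ℝ) < m := lt_trans (by positivity) hm1
    refine ⟨m, by exact_mod_cast hm0, ?_, fun v hv => ?_⟩
    · rw [div_lt_iff₀ hab] at hm1
      rw [div_lt_iff₀ hm0]
      linarith
    · have hva := sub_pos.2 (hA v hv)
      have h2 := (hM _ (mem_image_of_mem _ hv)).trans ((le_max_left _ _).trans hm.le)
      rw [div_le_iff₀ hva] at h2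
      rw [div_le_iff₀ hm0]
      linarith
  -- The first bound keeps the cluster error below ε₁, the second makes the (1−a)/t term of
  -- `IsCliqueSystem.mul_le` negligible.
  obtain ⟨t₁, ht₁⟩ := exists_nat_gt (max (3 * (4 * m + 1) / ε₁) (2 / (η * (c - b))))
  obtain ⟨Pm, hPm⟩ := exists_nat_gt (P + 1)
  set tm := max t₁ (m + 1) with htm
  have htm1 : m + 1 ≤ tm := le_max_right _ _
  have htm2 : 3 * (4 * m + 1) / ε₁ < tm ∧ 2 / (η * (c - b)) < tm := by
    have : (t₁ : ℝ) ≤ tm := by exact_mod_cast le_max_left _ _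
    exact ⟨((le_max_left _ _).trans_lt ht₁).trans_le this,
      ((le_max_right _ _).trans_lt ht₁).trans_le this⟩
  -- Each extension costs 2m points per clique; sizes stay at least `tm` throughout.
  set t : ℕ → ℕ := fun p => tm + 2 * m * (Pm + 1 - p) with ht
  have htle : ∀ p, t p ≤ t 0 := fun p => by
    simp only [ht]
    gcongr
    exact Nat.zero_le p
  have htge : ∀ p, tm ≤ t p := fun p => Nat.le_add_right _ _
  obtain ⟨ε₂, hε₂, K, hK, n₂, h2⟩ :=
    hU.exists_card_le_of_no_clique hA hA1 ha0 ha hbc hca hG (t 0)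
  set D := 4 ^ (Pm * t 0) * K with hD
  have hD0 : 0 ≤ D := by positivity
  obtain ⟨n₃, hn₃⟩ := exists_nat_gt (2 * D / δ)
  refine ⟨min ε₂ (η * (c - b) / (2 * (P + 1))), lt_min hε₂ (by positivity),
    max n₁ (max n₂ n₃), fun n hn B hB hPSD => ?_⟩
  have hnn₁ : n₁ ≤ n := (le_max_left _ _).trans hn
  have hnn₂ : n₂ ≤ n := ((le_max_left _ _).trans (le_max_right _ _)).trans hn
  have hnn₃ : n₃ ≤ n := ((le_max_right _ _).trans (le_max_right _ _)).trans hn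
  have hsys : ∀ p q (S : Fin p → Finset (EuclideanSpace ℝ (Fin n))),
      IsCliqueSystem B a b (t q) p S → (p : ℝ) ≤ P + η := by
    intro p q S hS
    set ε := η * (c - b) / (2 * (P + 1)) with hε
    have hεP : ε * (2 * (P + 1)) = η * (c - b) := div_mul_cancel₀ _ (by positivity)
    have hε0 : 0 < ε := by positivity
    have h3 := hS.mul_le (hPSD.mono_error (min_le_right _ _)) hbc hca ha
      (lt_of_lt_of_le (Nat.succ_pos m) (htm1.trans (htge q)))
    have htq : (tm : ℝ) ≤ t q := by exact_mod_cast htge q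
    have htq0 : (0 : ℝ) < t q := lt_trans (by positivity) (htm2.2.trans_le htq)
    have h4 : 1 / (t q : ℝ) * (1 - a) ≤ η * (c - b) / 2 := by
      have h5 := htm2.2.trans_le htq
      rw [div_lt_iff₀ (by positivity)] at h5
      have h6 : 1 / (t q : ℝ) ≤ η * (c - b) / 2 := by
        rw [div_le_iff₀ htq0]
        linarith
      refine le_trans (mul_le_of_le_one_right (by positivity) (by linarith)) h6
    have h7 : ε < c - b := by
      have : ε * 4 ≤ ε * (2 * (P + 1)) := by gcongr; linarith
      nlinarith
    refine le_of_mul_le_mul_right ?_ (sub_pos.2 h7)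
    have h8 : ε * (P + η) ≤ ε * (P + 1) := by gcongr
    nlinarith
  obtain ⟨p, hp, ⟨S, hS⟩, hmax⟩ : ∃ p ≤ Pm,
      (∃ S : Fin p → Finset (EuclideanSpace ℝ (Fin n)), IsCliqueSystem B a b (t p) p S) ∧
      ¬ ∃ S : Fin (p + 1) → Finset (EuclideanSpace ℝ (Fin n)),
        IsCliqueSystem B a b (t (p + 1)) (p + 1) S := by
    by_contra! hcon
    have hall : ∀ p ≤ Pm + 1,
        ∃ S : Fin p → Finset (EuclideanSpace ℝ (Fin n)), IsCliqueSystem B a b (t p) p S := by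
      intro p
      induction p with
      | zero => exact fun _ => ⟨Fin.elim0, fun i => i.elim0, fun i => i.elim0, fun i => i.elim0,
          fun i => i.elim0⟩
      | succ p ih => exact fun hp => hcon p (by omega) (ih (by omega))
    obtain ⟨S, hS⟩ := hall _ le_rfl
    have := hsys _ _ S hS
    push_cast at this
    linarith
  have htp : t (p + 1) + 2 * m ≤ t p := by
    have : Pm + 1 - p = Pm + 1 - (p + 1) + 1 := by omega
    simp only [ht, this]
    ring_nf
    omega
  have key := hS.card_le (D := K * (n : ℝ) ^ r) (Q := (C + δ₁) * (n : ℝ) ^ (r + 1)) hB ha0 ha hm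
    hmb hmA (le_trans (by omega) (htge (p + 1))) htp hmax (by
      intro R hR hno
      refine h2 n hnn₂ R (hB.subset hR) ((hPSD.subset hR).mono_error (min_le_left _ _)) ?_
      intro T hT hTe hTc
      obtain ⟨T', hT', hTc'⟩ := exists_subset_card_eq (s := T) (n := t (p + 1)) (by
        rw [hTc]
        exact htle _)
      exact hno T' (hT'.trans hT) (hTe.subset hT') hTc') (by
      intro R hR hPR
      refine h1 n hnn₁ R (hB.subset hR) (hPR.mono_error ?_)
      have htq : (tm : ℝ) ≤ t p := by exact_mod_cast htge p
      have h5 := htm2.1.trans_le htq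
      have htq0 : (0 : ℝ) < t p := lt_trans (by positivity) h5
      rw [div_lt_iff₀ hε₁] at h5
      rw [← mul_div_assoc, div_le_iff₀ htq0]
      linarith)
  have h6 : (4 : ℝ) ^ (p * t p) * (K * (n : ℝ) ^ r) ≤ D * (n : ℝ) ^ r := by
    rw [hD, mul_assoc]
    gcongr
    · norm_num
    · exact htle p
  have h7 : D * (n : ℝ) ^ r ≤ δ / 2 * (n : ℝ) ^ (r + 1) := by
    have h8 : 2 * D / δ < n := hn₃.trans_le (by exact_mod_cast hnn₃)
    rw [div_lt_iff₀ hδ] at h8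
    rw [pow_succ', ← mul_assoc]
    gcongr
    linarith
  have h9 : p * ((C + δ₁) * (n : ℝ) ^ (r + 1)) ≤ (C * P + δ / 2) * (n : ℝ) ^ (r + 1) := by
    rw [← mul_assoc]
    gcongr
    refine le_trans ?_ hPC
    gcongr
    exact hsys _ _ S hS
  calc (#B : ℝ) ≤ (C * P + δ / 2) * (n : ℝ) ^ (r + 1) + δ / 2 * (n : ℝ) ^ (r + 1) := by linarith
    _ = _ := by ring

/-- The sharp asymptotic bound for codes with `r + 1` nonnegative inner products. -/
theorem codeBound_insert (r : ℕ) : ∀ {A : Finset ℝ} {a b c : ℝ}, #A = r → (∀ v ∈ A, a < v) →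
    (∀ v ∈ A, v < 1) → 0 ≤ a → a < 1 → b < c → c ≤ a →
    CodeBound (insert a A) b c (2 ^ (r + 1) * r.factorial * (1 + (a - c) / (c - b))) (r + 1) := by
  induction r with
  | zero =>
    intro A a b c hA _ _ ha0 ha hbc hca
    rw [card_eq_zero] at hA
    subst hA
    -- With no higher product the row bound is the diagonal alone, and the constant is 2.
    have hU : UpperBound ∅ a 0 0 := by simp [UpperBound]
    have := (rowBound_empty ha (hbc.trans_le hca)).codeBound zero_le_one (by simp) ha
      (hbc.trans_le hca)
    simpa using hU.codeBound this (by simp) (by simp) ha0 ha hbc hca le_rfl (by norm_num)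
  | succ r ih =>
    intro A a b c hAr hA hA1 ha0 ha hbc hca
    have hba := hbc.trans_le hca
    have hG : (0 : ℝ) ≤ 2 ^ (r + 1) * r.factorial := by positivity
    -- For the products above a, the old a becomes the low threshold and a₂ the smallest product.
    have hU : UpperBound A a (2 ^ (r + 1) * r.factorial) (r + 1) := by
      intro a₂ ha₂ hmin c' hac' hca'
      rw [← insert_erase ha₂]
      refine ih ?_ ?_ (fun v hv => hA1 v (mem_of_mem_erase hv)) (ha0.trans (hA a₂ ha₂).le)
        (hA1 a₂ ha₂) hac' hca'
      · rw [card_erase_of_mem ha₂, hAr, Nat.add_sub_cancel]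
      · exact fun v hv => lt_of_le_of_ne (hmin v (mem_of_mem_erase hv)) (ne_of_mem_erase hv).symm
    have hrow := (hU.rowBound (b := b) hA hA1 ha hba hG).codeBound (by positivity) hA ha hba
    have := hU.codeBound hrow hA hA1 ha0 ha hbc hca hG (by positivity)
    convert this using 2
    rw [hAr, Nat.factorial_succ]
    push_cast
    ring

/-! ### A uniform bound -/

/-- Offsets v − c, relative to 1 − c, are either at most γ' (small) or above γ (large). A maximal
subset with only small products has polynomial size, and every other point is a large or low
neighbour of one of its members. -/
theorem NearPSD.card_le_of_gap {n : ℕ} {R : Finset (EuclideanSpace ℝ (Fin n))} {A : Finset ℝ}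
    {c β γ γ' D : ℝ} (hc : c < 1) (hβ : 0 < β) (hγ : 0 < γ) (hγ0 : 0 ≤ γ') (hγ1 : γ' < 1)
    (hγβ : γ' ≤ β ^ 2 / 2) (hγγ : γ' ≤ γ ^ 2 / 2)
    (hR : IsCode R A (c - β * (1 - c))) (hP : NearPSD R c 0)
    (hA : ∀ v ∈ A, v - c ≤ γ' * (1 - c) ∨ γ * (1 - c) < v - c) (hD0 : 0 ≤ D)
    (hD : ∀ R' ⊆ R, ∀ c' < 1, IsCode R' {v ∈ A | γ * (1 - c) < v - c}
      (c' - γ ^ 2 / 2 * (1 - c')) → NearPSD R' c' 0 → (#R' : ℝ) ≤ D) :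
    (#R : ℝ) ≤ (n + 1) ^ #{v ∈ A | v - c ≤ γ' * (1 - c)} *
      ((1 + #{v ∈ A | γ * (1 - c) < v - c} * D) * (1 + 2 / β ^ 2)) := by
  have hκ : 0 < 1 - c := sub_pos.2 hc
  set small := {v ∈ A | v - c ≤ γ' * (1 - c)} with hsmall
  set large := {v ∈ A | γ * (1 - c) < v - c} with hlarge
  set Δ := #large * D with hΔ
  have hΔ0 : 0 ≤ Δ := by positivity
  set hi : EuclideanSpace ℝ (Fin n) → Finset (EuclideanSpace ℝ (Fin n)) :=
    fun z => {x ∈ R | x ≠ z ∧ inner ℝ x z ∈ large} with hhi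
  set lo : EuclideanSpace ℝ (Fin n) → Finset (EuclideanSpace ℝ (Fin n)) :=
    fun z => {x ∈ R | inner ℝ x z ≤ c - β * (1 - c)} with hlo
  have hhic : ∀ z ∈ R, (#(hi z) : ℝ) ≤ Δ := by
    intro z hz
    have h1 : #(hi z) = ∑ v ∈ large, #{x ∈ hi z | inner ℝ x z = v} :=
      card_eq_sum_card_fiberwise fun x hx => (mem_filter.1 (mem_coe.1 hx)).2.2
    have h2 : ∀ v ∈ large, (#{x ∈ hi z | inner ℝ x z = v} : ℝ) ≤ D := by
      intro v hv
      set R' := {x ∈ hi z | inner ℝ x z = v} with hR'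
      have hR'R : R' ⊆ R := (filter_subset _ _).trans (filter_subset _ _)
      have hR'v : ∀ x ∈ R', x ≠ z ∧ inner ℝ x z = v := fun x hx =>
        ⟨(mem_filter.1 (mem_filter.1 hx).1).2.1, (mem_filter.1 hx).2⟩
      rcases R'.eq_empty_or_nonempty with he | ⟨x, hx⟩
      · rw [he]
        simpa using hD0
      have hv1 : v < 1 := by
        rw [← (hR'v x hx).2]
        exact inner_lt_one_of_ne (hR.1 x (hR'R hx)) (hR.1 z hz) (hR'v x hx).1
      have hvc : γ * (1 - c) < v - c := (mem_filter.1 hv).2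
      have hvc0 : 0 < v - c := lt_trans (by positivity) hvc
      have hlink := hP.link le_rfl hR'R hz (hR.1 z hz) (fun x hx => (hR'v x hx).2)
        (by linarith) hv1.le hc
      rw [mul_zero] at hlink
      have hq1 : (v - c) ^ 2 / (1 - c) < 1 - c := by
        rw [div_lt_iff₀ hκ]
        nlinarith
      have hq2 : γ ^ 2 * (1 - c) ≤ (v - c) ^ 2 / (1 - c) := by
        rw [le_div_iff₀ hκ]
        have : 0 ≤ γ * (1 - c) := by positivity
        nlinarith
      refine hD R' hR'R _ (by linarith) ⟨fun x hx => hR.1 x (hR'R hx), ?_⟩ hlink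
      intro x hx y hy hxy
      by_cases hl : inner ℝ x y ∈ large
      · exact Or.inl hl
      right
      have hs : inner ℝ x y - c ≤ γ' * (1 - c) := by
        rcases hR.2 x (hR'R hx) y (hR'R hy) hxy with h | h
        · exact (hA _ h).resolve_right fun h' => hl (mem_filter.2 ⟨h, h'⟩)
        · have : 0 ≤ β * (1 - c) := by positivity
          have : 0 ≤ γ' * (1 - c) := by positivity
          linarith
      -- Linking raises the shift by at least γ²(1−c), while small products exceed c by at most half
      -- of that: they become low, with relative gap γ²/2.
      have h3 : γ' * (1 - c) ≤ γ ^ 2 / 2 * (1 - c) := by gcongr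
      have h4 : 0 ≤ γ ^ 2 / 2 * ((v - c) ^ 2 / (1 - c)) := by positivity
      nlinarith
    have h3 := sum_le_card_nsmul _ _ _ h2
    rw [nsmul_eq_mul] at h3
    rw [h1]
    exact_mod_cast h3
  have hloc : ∀ z ∈ R, (#(lo z) : ℝ) ≤ 2 * (1 + Δ) / β ^ 2 := by
    intro z hz
    have hloR : lo z ⊆ R := filter_subset _ _
    -- With d = #(lo z), the terms involving z sum to at most −(1−c)β²d². The rows give
    -- (1−c)(1+Δ+γ'd)d, and γ' ≤ β²/2 absorbs the quadratic part.
    have key := hP.add_single le_rfl hloR hz (hR.1 z hz) (fun _ => 1) (β * #(lo z))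
    simp only [zero_mul, neg_zero, one_mul] at key
    have h1 : ∑ x ∈ lo z, (inner ℝ x z - c) ≤ #(lo z) • (-(β * (1 - c))) :=
      sum_le_card_nsmul _ _ _ fun x hx => by
        have := (mem_filter.1 hx).2
        linarith
    have h2 : ∀ x ∈ lo z, ∑ y ∈ lo z, (inner ℝ x y - c) ≤
        (1 - c) * (1 + Δ + γ' * #(lo z)) := by
      intro x hx
      have hxR := hloR hx
      calc _ ≤ ∑ y ∈ lo z, (1 - c) *
            ((if y = x then 1 else 0) + (if y ∈ hi x then 1 else 0) + γ') := by
            refine sum_le_sum fun y hy => ?_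
            have hyR := hloR hy
            have hle := inner_le_one (hR.1 x hxR) (hR.1 y hyR)
            have hγκ : 0 ≤ (1 - c) * γ' := by positivity
            by_cases hyx : y = x
            · rw [if_pos hyx]
              have : (0 : ℝ) ≤ if y ∈ hi x then 1 else 0 := by positivity
              nlinarith
            rw [if_neg hyx]
            by_cases hyi : y ∈ hi x
            · rw [if_pos hyi]
              linarith
            rw [if_neg hyi]
            rcases hR.2 x hxR y hyR (Ne.symm hyx) with h | h
            · have := (hA _ h).resolve_right fun h' => hyi (mem_filter.2 ⟨hyR, hyx, by
                rw [real_inner_comm]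
                exact mem_filter.2 ⟨h, h'⟩⟩)
              linarith
            · have : 0 ≤ β * (1 - c) := by positivity
              linarith
        _ = (1 - c) * (1 + #{y ∈ lo z | y ∈ hi x} + γ' * #(lo z)) := by
            rw [← mul_sum, sum_add_distrib, sum_add_distrib, sum_ite_eq', if_pos hx, sum_boole,
              sum_const, nsmul_eq_mul]
            ring
        _ ≤ _ := by
            have h3 : #{y ∈ lo z | y ∈ hi x} ≤ #(hi x) :=
              card_le_card fun y hy => (mem_filter.1 hy).2
            have h4 : (#{y ∈ lo z | y ∈ hi x} : ℝ) ≤ Δ :=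
              le_trans (by exact_mod_cast h3) (hhic x hxR)
            gcongr
    have h3 := sum_le_card_nsmul _ _ _ h2
    rw [nsmul_eq_mul] at h1 h3
    set d : ℝ := ((#(lo z) : ℕ) : ℝ) with hd
    have hd0 : 0 ≤ d := Nat.cast_nonneg _
    have h4 : 2 * (β * d) * ∑ x ∈ lo z, (inner ℝ x z - c) ≤
        2 * (β * d) * (d * (-(β * (1 - c)))) := by gcongr
    have h5 : (1 - c) * (d * (β ^ 2 * d)) ≤ (1 - c) * (d * (1 + Δ + γ' * d)) := by nlinarith
    have h6 := le_of_mul_le_mul_left h5 hκ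
    rw [le_div_iff₀ (by positivity)]
    rcases hd0.eq_or_lt with h0 | h0
    · rw [← h0]
      nlinarith
    · have h7 := le_of_mul_le_mul_left h6 h0
      have h8 : γ' * d ≤ β ^ 2 / 2 * d := by gcongr
      nlinarith
  obtain ⟨I, hI, hImax⟩ := exists_max_image
    {I ∈ R.powerset | ∀ x ∈ I, ∀ y ∈ I, x ≠ y → inner ℝ x y ∈ small} card
    ⟨∅, by simp⟩
  rw [mem_filter, mem_powerset] at hI
  have hIc : (#I : ℝ) ≤ (n + 1) ^ #small := by
    have := card_le_of_inner_mem (fun x hx => hR.1 x (hI.1 hx)) small (fun a ha => by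
      have := (mem_filter.1 ha).2
      nlinarith) hI.2
    exact_mod_cast this
  have hcover : R ⊆ I.biUnion fun y => insert y (hi y ∪ lo y) := by
    intro x hx
    rw [mem_biUnion]
    by_cases hxI : x ∈ I
    · exact ⟨x, hxI, mem_insert_self _ _⟩
    by_contra! hcon
    have hxy : ∀ y ∈ I, inner ℝ x y ∈ small := by
      intro y hy
      have hne : x ≠ y := fun h => hxI (h ▸ hy)
      have h1 := hcon y hy
      rw [mem_insert, mem_union, not_or, not_or] at h1
      rcases hR.2 x hx y (hI.1 hy) hne with h | h
      · refine mem_filter.2 ⟨h, (hA _ h).resolve_right fun h' => h1.2.1 ?_⟩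
        exact mem_filter.2 ⟨hx, hne, mem_filter.2 ⟨h, h'⟩⟩
      · exact absurd (mem_filter.2 ⟨hx, h⟩) h1.2.2
    have h2 := hImax (insert x I) (mem_filter.2 ⟨mem_powerset.2 (insert_subset hx hI.1), by
      intro u hu w hw huw
      rw [mem_insert] at hu hw
      rcases hu with rfl | hu <;> rcases hw with rfl | hw
      · exact absurd rfl huw
      · exact hxy w hw
      · rw [real_inner_comm]
        exact hxy u hu
      · exact hI.2 u hu w hw huw⟩)
    rw [card_insert_of_notMem hxI] at h2
    omega
  have h1 : (#R : ℝ) ≤ ∑ y ∈ I, (#(insert y (hi y ∪ lo y)) : ℝ) := by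
    exact_mod_cast (card_le_card hcover).trans card_biUnion_le
  have h2 : ∀ y ∈ I, (#(insert y (hi y ∪ lo y)) : ℝ) ≤ (1 + Δ) * (1 + 2 / β ^ 2) := by
    intro y hy
    have h3 : #(insert y (hi y ∪ lo y)) ≤ #(hi y) + #(lo y) + 1 :=
      (card_insert_le _ _).trans (Nat.add_le_add_right (card_union_le _ _) 1)
    have h4 : (#(insert y (hi y ∪ lo y)) : ℝ) ≤ #(hi y) + #(lo y) + 1 := by exact_mod_cast h3
    have h5 := hhic y (hI.1 hy)
    have h6 := hloc y (hI.1 hy)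
    have e : (1 + Δ) * (1 + 2 / β ^ 2) = 1 + Δ + 2 * (1 + Δ) / β ^ 2 := by ring
    linarith
  have h3 := h1.trans (sum_le_card_nsmul _ _ _ h2)
  rw [nsmul_eq_mul] at h3
  refine h3.trans ?_
  gcongr

/-- Thresholds decreasing so fast that each is at most half of the square of its predecessor. -/
noncomputable def threshold (γ₀ : ℝ) : ℕ → ℝ
  | 0 => γ₀
  | j + 1 => threshold γ₀ j ^ 2 / 2

theorem threshold_pos {γ₀ : ℝ} (h : 0 < γ₀) (j : ℕ) : 0 < threshold γ₀ j := by
  induction j with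
  | zero => exact h
  | succ j ih =>
    rw [threshold]
    positivity

theorem threshold_le {γ₀ : ℝ} (h : 0 < γ₀) (h1 : γ₀ ≤ 1) (j : ℕ) : threshold γ₀ j ≤ γ₀ := by
  induction j with
  | zero => exact le_rfl
  | succ j ih =>
    rw [threshold]
    have := threshold_pos h j
    nlinarith

theorem threshold_antitone {γ₀ : ℝ} (h : 0 < γ₀) (h1 : γ₀ ≤ 1) : Antitone (threshold γ₀) :=
  antitone_nat_of_succ_le fun j => by
    rw [threshold]
    have := threshold_pos h j
    have := threshold_le h h1 j
    nlinarith

/-- Among `k` intervals one avoids a given set of fewer than `k` numbers. -/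
theorem exists_threshold_gap {γ₀ : ℝ} (h : 0 < γ₀) (h1 : γ₀ ≤ 1) {k : ℕ} {A : Finset ℝ}
    (hA : #A < k) (μ : ℝ → ℝ) :
    ∃ j < k, ∀ v ∈ A, μ v ≤ threshold γ₀ (j + 1) ∨ threshold γ₀ j < μ v := by
  by_contra! hcon
  choose! v hvA hv using hcon
  have hinj : Set.InjOn v (range k) := by
    have hlt : ∀ i ∈ range k, ∀ j ∈ range k, i < j → v i ≠ v j := by
      intro i hi j hj hij heq
      have h2 := (hv i (mem_range.1 hi)).1
      have h3 := (hv j (mem_range.1 hj)).2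
      rw [heq] at h2
      have := threshold_antitone h h1 (Nat.succ_le_of_lt hij)
      simp only [Nat.succ_eq_add_one] at this
      linarith
    intro i hi j hj heq
    rcases lt_trichotomy i j with hij | hij | hij
    · exact absurd heq (hlt i hi j hj hij)
    · exact hij
    · exact absurd heq.symm (hlt j hj i hi hij)
  have := card_le_card_of_injOn v (fun i hi => hvA i (mem_range.1 hi)) hinj
  rw [card_range] at this
  omega

/-- Measuring the gap relative to 1 − c makes the statement stable under changing the shift, so
strong induction yields a constant independent of `A`. -/
theorem exists_card_le_mul_pow (k : ℕ) : ∀ β > 0, ∃ C > 0, ∀ (n : ℕ)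
    (B : Finset (EuclideanSpace ℝ (Fin n))) (A : Finset ℝ), ∀ c < 1, #A ≤ k →
      IsCode B A (c - β * (1 - c)) → NearPSD B c 0 → (#B : ℝ) ≤ C * ((n : ℝ) + 1) ^ k := by
  induction k using Nat.strong_induction_on with
  | _ k ih =>
  intro β hβ
  choose! Cf hCf0 hCf using ih
  set γ₀ := min ((β / 2) ^ 2 / 2) (1 / 2) with hγ₀
  have hγ0 : 0 < γ₀ := lt_min (by positivity) (by norm_num)
  have hγ12 : γ₀ ≤ 1 / 2 := min_le_right _ _
  have hγ1 : γ₀ ≤ 1 := hγ12.trans (by norm_num)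
  have hpos := threshold_pos hγ0
  set g : ℕ → ℝ := fun j => threshold γ₀ j ^ 2 / 2 with hg
  have hg0 : ∀ j, 0 < g j := fun j => by
    have := hpos j
    simp only [hg]
    positivity
  -- Dominates the inductive constant for every possible number i of large products and threshold
  -- index j.
  set C₀ := ∑ i ∈ range k, ∑ j ∈ range k, Cf i (g j) with hC₀
  have hC0 : 0 ≤ C₀ := sum_nonneg fun i hi => sum_nonneg fun j _ =>
    (hCf0 i (mem_range.1 hi) _ (hg0 j)).le
  have hCle : ∀ i < k, ∀ j < k, Cf i (g j) ≤ C₀ := by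
    intro i hi j hj
    refine le_trans ?_ (single_le_sum (f := fun i => ∑ j ∈ range k, Cf i (g j))
      (fun i hi => sum_nonneg fun j _ => (hCf0 i (mem_range.1 hi) _ (hg0 j)).le)
      (mem_range.2 hi))
    exact single_le_sum (f := fun j => Cf i (g j)) (fun j _ => (hCf0 i hi _ (hg0 j)).le)
      (mem_range.2 hj)
  -- The first bound excludes low cliques and lets the relative gap shrink only from β to β/2; the
  -- second makes v itself a small product.
  obtain ⟨t, ht⟩ := exists_nat_gt (max (2 + (4 + 2 * β) / β) (1 / threshold γ₀ k))
  have ht1 : 2 + (4 + 2 * β) / β < t := (le_max_left _ _).trans_lt ht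
  have ht2 : 1 / threshold γ₀ k < t := (le_max_right _ _).trans_lt ht
  have htβ : 0 < (4 + 2 * β) / β := by positivity
  have ht2' : (2 : ℝ) < t := by linarith
  have htN : 2 < t := by exact_mod_cast ht2'
  have ht3 : 4 + 2 * β < (t - 1) * β := by
    have : (4 + 2 * β) / β < t - 1 := by linarith
    rwa [div_lt_iff₀ hβ] at this
  obtain ⟨K, hK, hRam⟩ := IsCode.exists_clique k t
  have hK0 : (0 : ℝ) < K := by exact_mod_cast hK
  refine ⟨K + K * ((1 + k * C₀) * (1 + 2 / (β / 2) ^ 2)), by positivity, ?_⟩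
  intro n B A c hc hA hB hP
  have hκ : 0 < 1 - c := sub_pos.2 hc
  have hn1 : (1 : ℝ) ≤ (n : ℝ) + 1 := le_add_of_nonneg_left n.cast_nonneg
  have hpow : (1 : ℝ) ≤ ((n : ℝ) + 1) ^ k := one_le_pow₀ hn1
  by_cases hKB : K ≤ #B
  swap
  · have h1 : (#B : ℝ) ≤ K := by exact_mod_cast (not_le.1 hKB).le
    have h2 : 0 ≤ (K : ℝ) * ((1 + k * C₀) * (1 + 2 / (β / 2) ^ 2)) := by positivity
    nlinarith
  rcases hRam B A _ hA hB hKB with ⟨S, hS, hSc, hlow⟩ | ⟨v, hv, S, hS, R, hRB, hSc, hBR, hSv, hjoin⟩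
  · exfalso
    have h1 := hP.low_clique hS (card_pos.1 (by omega)) hB.1 hlow
    rw [hSc] at h1
    have h2 : (t - 1 : ℝ) * (c - (c - β * (1 - c))) = ((t - 1) * β) * (1 - c) := by ring
    rw [h2] at h1
    nlinarith
  have hSne : S.Nonempty := card_pos.1 (by omega)
  have hv1 : v < 1 := by
    obtain ⟨x, hx, y, hy, hxy⟩ := one_lt_card.1 (show 1 < #S by omega)
    rw [← hSv.2 x hx y hy hxy]
    exact inner_lt_one_of_ne (hSv.1 x hx) (hSv.1 y hy) hxy
  have ht0 : (0 : ℝ) < t := by linarith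
  -- This is 2v − ‖avg S‖², so positivity holds with no error.
  set c' := v - (1 - v) / t with hc'
  have hPR : NearPSD R c' 0 := by
    have := NearPSD.of_center fun x hx => inner_avg_eq hSne fun y hy => (hjoin x hx y hy).2
    rw [hSv.norm_avg_sq hSne, hSc] at this
    convert this using 1
    rw [hc']
    ring
  have hκv : 0 < 1 - v := sub_pos.2 hv1
  have hq : 0 < (1 - v) / t := by positivity
  have hqt : (1 - v) / t * t = 1 - v := div_mul_cancel₀ _ ht0.ne'
  have hc'1 : c' < 1 := by linarith
  have hκ' : 0 < 1 - c' := sub_pos.2 hc'1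
  have hcc : (1 + β / 2) * (1 - c') ≤ (1 + β) * (1 - c) := by
    -- Positivity on the clique keeps v from falling far below c.
    have h1 : (t - 1) * (1 - v) ≤ t * (1 - c) := by
      have h2 := (hP.subset hS).sum_nonneg_of_row hSne (ρ := 1 - c + (t - 1) * (v - c)) (by
        intro x hx
        rw [← add_sum_erase S _ hx, real_inner_self_eq_norm_sq, hSv.1 x hx,
          sum_congr rfl fun y hy => by
            rw [hSv.2 x hx y (mem_of_mem_erase hy) (ne_of_mem_erase hy).symm],
          sum_const, card_erase_of_mem hx, nsmul_eq_mul, hSc, Nat.cast_sub (by omega)]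
        push_cast
        linarith)
      linarith
    have h3 : t * (1 - c') = (t + 1) * (1 - v) := by
      rw [hc']
      linarith
    have h4 : (1 + β / 2) * (t + 1) ≤ (1 + β) * (t - 1) := by nlinarith
    have h5 : ((t - 1) * t) * ((1 + β / 2) * (1 - c')) ≤
        ((t - 1) * t) * ((1 + β) * (1 - c)) := by
      calc ((t - 1) * t) * ((1 + β / 2) * (1 - c'))
          = ((1 + β / 2) * (t + 1)) * ((t - 1) * (1 - v)) := by
            linear_combination ((t - 1) * (1 + β / 2)) * h3
        _ ≤ ((1 + β) * (t - 1)) * (t * (1 - c)) := by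
            have : (0 : ℝ) ≤ t - 1 := by linarith
            gcongr
        _ = _ := by ring
    exact le_of_mul_le_mul_left h5 (mul_pos (by linarith) ht0)
  have hRcode : IsCode R A (c' - β / 2 * (1 - c')) := by
    refine ⟨fun x hx => hB.1 x (hRB hx), fun x hx y hy hxy => ?_⟩
    refine (hB.2 x (hRB hx) y (hRB hy) hxy).imp_right fun h => ?_
    linarith
  obtain ⟨j, hjk, hj⟩ := exists_threshold_gap hγ0 hγ1 (k := k) (A := A.erase v) (by
    rw [card_erase_of_mem hv]
    have := card_pos.2 ⟨v, hv⟩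
    omega) fun u => (u - c') / (1 - c')
  have hvsmall : v - c' ≤ threshold γ₀ (j + 1) * (1 - c') := by
    have h1 : threshold γ₀ k ≤ threshold γ₀ (j + 1) := threshold_antitone hγ0 hγ1 hjk
    have h2 : 1 < threshold γ₀ k * t := by
      rw [div_lt_iff₀ (hpos k)] at ht2
      linarith
    have h3 : v - c' = (1 - v) / t := by rw [hc']; ring
    rw [h3, div_le_iff₀ ht0]
    calc 1 - v ≤ 1 * (1 - c') := by linarith
      _ ≤ (threshold γ₀ (j + 1) * t) * (1 - c') := by
        gcongr
        exact h2.le.trans (by gcongr)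
      _ = _ := by ring
  have hgap : ∀ u ∈ A, u - c' ≤ threshold γ₀ (j + 1) * (1 - c') ∨
      threshold γ₀ j * (1 - c') < u - c' := by
    intro u hu
    by_cases huv : u = v
    · rw [huv]
      exact Or.inl hvsmall
    · exact (hj u (mem_erase.2 ⟨huv, hu⟩)).imp (div_le_iff₀ hκ').1 (lt_div_iff₀ hκ').1
  set small := {u ∈ A | u - c' ≤ threshold γ₀ (j + 1) * (1 - c')} with hsmall
  set large := {u ∈ A | threshold γ₀ j * (1 - c') < u - c'} with hlarge
  have hlt : threshold γ₀ (j + 1) ≤ threshold γ₀ j := threshold_antitone hγ0 hγ1 (Nat.le_succ j)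
  have hcard : #small + #large ≤ k := by
    rw [← card_union_of_disjoint]
    · exact (card_le_card (union_subset (filter_subset _ _) (filter_subset _ _))).trans hA
    · refine disjoint_filter.2 fun u _ h1 h2 => ?_
      have : threshold γ₀ (j + 1) * (1 - c') ≤ threshold γ₀ j * (1 - c') := by gcongr
      linarith
  -- Since v is small, fewer than k products are large and the induction applies.
  have hsmall0 : 0 < #small := card_pos.2 ⟨v, mem_filter.2 ⟨hv, hvsmall⟩⟩
  have hlk : #large < k := by omega
  have hjle : threshold γ₀ (j + 1) ≤ γ₀ := threshold_le hγ0 hγ1 _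
  have key := hPR.card_le_of_gap (D := C₀ * ((n : ℝ) + 1) ^ #large) hc'1 (half_pos hβ) (hpos j)
    (hpos (j + 1)).le (by linarith) (hjle.trans (min_le_left _ _)) le_rfl hRcode hgap
    (by positivity) (by
      intro R' _ c'' hc'' hcode hP''
      refine (hCf #large hlk (g j) (hg0 j) n R' large c'' hc'' le_rfl hcode hP'').trans ?_
      gcongr
      exact hCle _ hlk _ hjk)
  rw [← hlarge, ← hsmall] at key
  have h1 : 1 + (#large : ℝ) * (C₀ * ((n : ℝ) + 1) ^ #large) ≤
      (1 + k * C₀) * ((n : ℝ) + 1) ^ #large := by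
    have h2 : (1 : ℝ) ≤ ((n : ℝ) + 1) ^ #large := one_le_pow₀ hn1
    have h3 : (#large : ℝ) * (C₀ * ((n : ℝ) + 1) ^ #large) ≤
        k * (C₀ * ((n : ℝ) + 1) ^ #large) := by gcongr
    linarith
  calc (#B : ℝ) ≤ K * #R := by exact_mod_cast hBR
    _ ≤ K * (((n : ℝ) + 1) ^ #small *
        (((1 + k * C₀) * ((n : ℝ) + 1) ^ #large) * (1 + 2 / (β / 2) ^ 2))) := by
      gcongr
      refine key.trans ?_
      gcongr
    _ = K * ((1 + k * C₀) * (1 + 2 / (β / 2) ^ 2)) * ((n : ℝ) + 1) ^ (#small + #large) := by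
      rw [pow_add]
      ring
    _ ≤ (K + K * ((1 + k * C₀) * (1 + 2 / (β / 2) ^ 2))) * ((n : ℝ) + 1) ^ k := by
      gcongr
      linarith

/-! ### Deducing the bounds for spherical codes. -/

theorem IsSphericalCode.isCode {n k : ℕ} {β : ℝ} {α : Fin k → ℝ}
    {C : Finset (EuclideanSpace ℝ (Fin n))} (h : IsSphericalCode (codeAngles β α) C) :
    IsCode C (univ.image α) (-β) := by
  refine ⟨h.2.1, fun x hx y hy hxy => ?_⟩
  rcases h.2.2 x hx y hy hxy with h | ⟨i, hi⟩
  · exact Or.inr h.2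
  · exact Or.inl (mem_image.2 ⟨i, mem_univ i, hi⟩)

theorem IsSphericalCode.pos_dim {n : ℕ} {L : Set ℝ} {C : Finset (EuclideanSpace ℝ (Fin n))}
    (h : IsSphericalCode L C) : 0 < n := by
  obtain ⟨x, hx⟩ := h.1
  rcases Nat.eq_zero_or_pos n with rfl | hn
  · have := h.2.1 x hx
    rw [Subsingleton.elim x 0, norm_zero] at this
    exact absurd this zero_ne_one
  · exact hn

theorem nearPSD_zero {V : Type*} [NormedAddCommGroup V] [InnerProductSpace ℝ V] (B : Finset V) :
    NearPSD B 0 0 := by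
  simpa using NearPSD.of_center (B := B) (s := 0) (θ := 0) (by simp)

theorem exists_card_le_of_isSphericalCode {β : ℝ} (hβ : 0 < β) (k : ℕ) :
    ∃ c : ℝ, ∀ (α : Fin k → ℝ) (n : ℕ) (C : Finset (EuclideanSpace ℝ (Fin n))),
      IsSphericalCode (codeAngles β α) C → (C.card : ℝ) ≤ c * (n : ℝ) ^ k := by
  obtain ⟨c, hc, h⟩ := exists_card_le_mul_pow k β hβ
  refine ⟨c * 2 ^ k, fun α n C hC => ?_⟩
  have hn : (1 : ℝ) ≤ n := by exact_mod_cast hC.pos_dim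
  calc (#C : ℝ) ≤ c * ((n : ℝ) + 1) ^ k :=
        h n C (univ.image α) 0 one_pos (card_image_le.trans (by simp))
          (by simpa using hC.isCode) (nearPSD_zero C)
    _ ≤ c * (2 * n) ^ k := by
        gcongr
        linarith
    _ = _ := by rw [mul_pow, mul_assoc]

theorem codeBound_image {β : ℝ} (hβ : 0 < β) {k : ℕ} (hk : 0 < k) {α : Fin k → ℝ}
    (hα : StrictMono α) (h01 : ∀ i, 0 ≤ α i ∧ α i < 1) :
    CodeBound (univ.image α) (-β) 0
      (2 ^ k * ((k - 1).factorial : ℝ) * (1 + α ⟨0, hk⟩ / β)) k := by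
  obtain ⟨r, rfl⟩ : ∃ r, k = r + 1 := ⟨k - 1, by omega⟩
  have hmem : α ⟨0, hk⟩ ∈ univ.image α := mem_image_of_mem _ (mem_univ _)
  have hcard : #(univ.image α) = r + 1 := by
    rw [card_image_of_injective _ hα.injective, card_univ, Fintype.card_fin]
  have := codeBound_insert r (A := (univ.image α).erase (α ⟨0, hk⟩)) (a := α ⟨0, hk⟩) (b := -β)
    (c := 0) (by rw [card_erase_of_mem hmem, hcard, Nat.add_sub_cancel]) (by
      intro v hv
      obtain ⟨hv0, hv⟩ := mem_erase.1 hv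
      obtain ⟨i, -, rfl⟩ := mem_image.1 hv
      exact lt_of_le_of_ne (hα.monotone (Fin.zero_le i)) hv0.symm) (by
      intro v hv
      obtain ⟨i, -, rfl⟩ := mem_image.1 (mem_of_mem_erase hv)
      exact (h01 i).2) (h01 _).1 (h01 _).2 (by linarith) (h01 _).1
  rw [insert_erase hmem] at this
  simpa using this

end SphericalCodes

theorem mainTheorem2 (β : ℝ) (hβ₀ : 0 < β) (hβ₁ : β ≤ 1) (k : ℕ) :
    (∃ c : ℝ, ∀ (α : Fin k → ℝ) (n : ℕ) (C : Finset (EuclideanSpace ℝ (Fin n))),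
      IsSphericalCode (codeAngles β α) C → (C.card : ℝ) ≤ c * (n : ℝ) ^ k) ∧
    (∀ (hk : 0 < k) (α : Fin k → ℝ), StrictMono α → (∀ i, 0 ≤ α i ∧ α i < 1) →
      ∃ f : ℕ → ℝ, f =o[Filter.atTop] (fun n : ℕ => (n : ℝ) ^ k) ∧
        ∀ (n : ℕ) (C : Finset (EuclideanSpace ℝ (Fin n))),
          IsSphericalCode (codeAngles β α) C →
            (C.card : ℝ) ≤
              2 ^ k * ((k - 1).factorial : ℝ) * (1 + α ⟨0, hk⟩ / β) * (n : ℝ) ^ k + f n) := by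
  have hpart := exists_card_le_of_isSphericalCode hβ₀ k
  refine ⟨hpart, fun hk α hα h01 => ?_⟩
  obtain ⟨c, hc⟩ := hpart
  have hbound := codeBound_image hβ₀ hk hα h01
  set M := 2 ^ k * ((k - 1).factorial : ℝ) * (1 + α ⟨0, hk⟩ / β) with hM
  have hM0 : 0 ≤ M := by
    have := (h01 ⟨0, hk⟩).1
    positivity
  set s : ℕ → Set ℝ := fun n => {m | ∃ C : Finset (EuclideanSpace ℝ (Fin n)),
    IsSphericalCode (codeAngles β α) C ∧ (C.card : ℝ) = m} with hs
  -- The error is the worst excess over all codes; the uniform bound makes the supremum finite for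
  -- every n, including those below the asymptotic range.
  refine ⟨fun n => max 0 (sSup (s n) - M * (n : ℝ) ^ k), ?_, fun n C hC => ?_⟩
  · rw [Asymptotics.isLittleO_iff]
    intro δ hδ
    obtain ⟨ε, hε, n₀, h⟩ := hbound δ hδ
    filter_upwards [Filter.eventually_ge_atTop n₀] with n hn
    have hn0 : (0 : ℝ) ≤ (n : ℝ) ^ k := by positivity
    rw [Real.norm_of_nonneg (le_max_left _ _), Real.norm_of_nonneg hn0]
    refine max_le (by positivity) ?_
    have : sSup (s n) ≤ (M + δ) * (n : ℝ) ^ k := by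
      refine Real.sSup_le ?_ (by positivity)
      rintro m ⟨C, hC, rfl⟩
      exact h n hn C hC.isCode ((nearPSD_zero C).mono_error hε.le)
    linarith
  · have hbdd : BddAbove (s n) := by
      refine ⟨c * (n : ℝ) ^ k, ?_⟩
      rintro m ⟨C, hC, rfl⟩
      exact hc α n C hC
    have h1 : (C.card : ℝ) ≤ sSup (s n) := le_csSup hbdd ⟨C, hC, rfl⟩
    have h2 := le_max_right 0 (sSup (s n) - M * (n : ℝ) ^ k)
    linarith
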